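/- **Calculi.** Fix a countably infinite set of names; processes are considered up to $\alpha$-conversion. *CPC.* Patterns are $p ::= \lambda x \mid x \mid \ulcorner x\urcorner \mid p\bullet p$ (binding, variable, protected names; compounds, associating to the left), with the binding names of a pattern pairwise distinct and different from its free names. A pattern is communicable if it has no binding and no protected names; substitutions map names to communicable patterns, and $\ulcorner p\bullet q\urcorner=\ulcorner p\urcorner\bullet\ulcorner q\urcorner$. Unification $\{p\|q\}$ is the partial function with $\{x\|x\}=\{x\|\ulcorner x\urcorner\}=\{\ulcorner x\urcorner\|x\}=\{\ulcorner x\urcorner\|\ulcorner x\urcorner\}=(\{\},\{\})$; $\{\lambda x\|q\}=(\{q/x\},\{\})$ and $\{q\|\lambda x\}=(\{\},\{q/x\})$ for $q$ communicable; $\{p_1\bullet p_2\|q_1\bullet q_2\}=(\sigma_1\cup\sigma_2,\rho_1\cup\rho_2)$ if $\{p_i\|q_i\}=(\sigma_i,\rho_i)$ for $i=1,2$; undefined otherwise. Processes are $P::=\mathbf 0\mid\surd\mid P|P\mid\,!P\mid(\nu x)P\mid p\to P$, where $p\to P$ binds the binding names of $p$ in $P$, and $p$ alone abbreviates $p\to\mathbf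 0$. Structural congruence $\equiv$ is the congruence generated by: $|$ is a commutative monoid with unit $\mathbf 0$, $(\nu n)\mathbf 0\equiv\mathbf 0$, $(\nu n)(\nu m)P\equiv(\nu m)(\nu n)P$, $!P\equiv P|!P$, and $P|(\nu n)Q\equiv(\nu n)(P|Q)$ for $n\notin\mathrm{fn}(P)$. Reduction $\mapsto$ is generated by $(p\to P)|(q\to Q)\mapsto\sigma P|\rho Q$ if $\{p\|q\}=(\sigma,\rho)$, and closed under parallel composition, restriction and $\equiv$. $P$ exhibits the barb $\tilde m$ if $P\equiv(\nu\tilde n)(p\to P'|P'')$ with no protected name of $p$ in $\tilde n$ and $\tilde m=\mathrm{fn}(p)\setminus\tilde n$. Barbed congruence $\simeq$ is the largest relation on CPC processes that is symmetric, preserves barbs, is reduction closed ($P\mathrel R Q$ and $P\mapsto P'$ imply $Q\mapsto Q'$ with $P'\mathrel R Q'$) and is closed under all one-hole CPC contexts. *Spi calculus.* Terms are $M::=n\mid(M,N)\mid 0\mid \mathit{suc}(M)\mid\{M\}_N$ with $n$ a name (variables are names; a numeral $i>0$ is the $i$-th successor of $0$). Processes are $$\begin{aligned}P::={}&\mathbf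 0\mid\surd\mid P|P\mid\,!P\mid(\nu m)P\mid M(x).P\mid\overline M\langle N\rangle.P\mid[M\text{ is }N]P\mid\text{let }(x,y)=M\text{ in }P\\&\mid\text{case }M\text{ of }\{x\}_N:P\mid\text{case }M\text{ of }0:P\ suc(x):Q\end{aligned}$$ with $x\neq y$ in a splitting, and the same structural congruence laws. Reduction is generated by $$\begin{aligned}\overline M\langle N\rangle.P\,|\,M(x).Q&\mapsto P\,|\,\{N/x\}Q, & [M\text{ is }M]P&\mapsto P,\\ \text{let }(x,y)=(M,N)\text{ in }P&\mapsto\{M/x,N/y\}P, & \text{case }\{M\}_N\text{ of }\{x\}_N:P&\mapsto\{M/x\}P,\\ \text{case }0\text{ of }0:P\ suc(x):Q&\mapsto P, & \text{case }suc(N)\text{ of }0:P\ suc(x):Q&\mapsto\{N/x\}Q,\end{aligned}$$ and is closed under parallel composition, restriction and $\equiv$. **The encoding.** Let $\iota$ be an injection of the Spi names into the CPC names, and let $\mathsf{pair},\mathsf{encr},\mathsf 0,\mathsf{suc},\mathsf{in}$ be distinct (reserved) CPC names outside the range of $\iota$. Terms become communicable patterns: $[\![n]\!]=\iota(n)$,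 $[\![0]\!]=\mathsf 0$, $[\![suc(M)]\!]=\mathsf{suc}\bullet[\![M]\!]$, $[\![(M,N)]\!]=\mathsf{pair}\bullet[\![M]\!]\bullet[\![N]\!]$, $[\![\{M\}_N]\!]=\mathsf{encr}\bullet[\![M]\!]\bullet[\![N]\!]$. On processes $[\![\cdot]\!]$ is homomorphic for $\mathbf 0,\surd,|,!,\nu$, and (identifying a Spi name with its image under $\iota$; $n$ and the $x$ of the output clause are fresh) $$\begin{aligned} [\![M(x).P]\!]&=[\![M]\!]\bullet\lambda x\bullet\mathsf{in}\to[\![P]\!]\\ [\![\overline M\langle N\rangle.P]\!]&=[\![M]\!]\bullet[\![N]\!]\bullet\lambda x\to[\![P]\!]\\ [\![[M\text{ is }N]P]\!]&=(\nu n)(\ulcorner n\urcorner\bullet[\![M]\!]\to[\![P]\!]\;|\;\ulcorner n\urcorner\bullet[\![N]\!])\\ [\![\text{let }(x,y)=M\text{ in }P]\!]&=(\nu n)(\ulcorner n\urcorner\bullet(\ulcorner\mathsf{pair}\urcorner\bullet\lambda x\bullet\lambda y)\to[\![P]\!]\;|\;\ulcorner n\urcorner\bullet[\![M]\!])\\ [\![\text{case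 }M\text{ of }\{x\}_N:P]\!]&=(\nu n)(\ulcorner n\urcorner\bullet(\ulcorner\mathsf{encr}\urcorner\bullet\lambda x\bullet[\![N]\!])\to[\![P]\!]\;|\;\ulcorner n\urcorner\bullet[\![M]\!])\\ [\![\text{case }M\text{ of }0:P\ suc(x):Q]\!]&=(\nu n)(\ulcorner n\urcorner\bullet\ulcorner\mathsf 0\urcorner\to[\![P]\!]\;|\;\ulcorner n\urcorner\bullet(\ulcorner\mathsf{suc}\urcorner\bullet\lambda x)\to[\![Q]\!]\;|\;\ulcorner n\urcorner\bullet[\![M]\!]) \end{aligned}$$ **Theorem.** Write $\Mapsto$ for the reflexive-transitive closure of $\mapsto$, $P\mapsto^\omega$ if $P$ has an infinite sequence of reductions, and $P\Downarrow$ if $P\Mapsto P'\equiv P''|\surd$ for some $P',P''$. (A) The encoding $[\![\cdot]\!]$, with the renaming policy $\varphi(a)=(\iota(a))$ (a tuple of length one), is valid: 1. *Compositionality.* For every $k$-ary Spi operator $\mathsf{op}$ (with its terms and bound names) and every set of names $N$ there is a $k$-ary CPC context $C$ (each of its $k$ holes occurs exactly once, and its binders may capture) such that $[\![\mathsf{op}(S_1,\dots,S_k)]\!]=C[[\![S_1]\!];\dots;[\![S_k]\!]]$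 for all $S_1,\dots,S_k$ with $\mathrm{fn}(S_1,\dots,S_k)=N$. Here the free names of a pattern in $C$ lie outside the scope of its binding names. 2. *Name invariance.* For every name substitution $\sigma$ there is a substitution $\sigma'$ of CPC names with $\varphi(\sigma(a))=\sigma'(\varphi(a))$ for every Spi name $a$, and fixing every name not occurring in any $\varphi(a)$, such that for every $S$: $[\![\sigma S]\!]=\sigma'[\![S]\!]$ if $\sigma$ is injective, and $[\![\sigma S]\!]\simeq\sigma'[\![S]\!]$ otherwise. 3. *Operational correspondence.* If $S\Mapsto S'$ then $[\![S]\!]\Mapsto\simeq[\![S']\!]$; if $[\![S]\!]\Mapsto T$ then there is $S'$ with $S\Mapsto S'$ and $T\Mapsto\simeq[\![S']\!]$. 4. *Divergence reflection.* If $[\![S]\!]\mapsto^\omega$ then $S\mapsto^\omega$. 5. *Success sensitiveness.* $S\Downarrow$ if and only if $[\![S]\!]\Downarrow$. (B) Reductions are preserved and reflected up to $\simeq$: if $P\mapsto P'$ then $[\![P]\!]\mapsto\simeq[\![P']\!]$; and if $[\![P]\!]\mapsto Q$ then $Q\simeq[\![P']\!]$ for some $P'$ with $P\mapsto P'$. 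-/

import Mathlib

/-!
Conventions.  Names are natural numbers.  Processes are taken up to alpha-conversion, which is
realised by de Bruijn indices: inside `k` binders the indices `0, ..., k - 1` are the bound names
(`0` for the innermost binder) and the index `n + k` is the name `n` of the scope outside these
binders.  A construct that binds several names at once (a case, a pair splitting) numbers them from
left to right.  `closeNames` turns a process with chosen names for its binders into this form.
-/

/-- The passage under binders that are called `xs` (pairwise distinct names): the name `xs[i]`
becomes the bound index `i`, every other name is moved under the binders. -/
def closeNames (xs : List ℕ) (n : ℕ) : ℕ :=
  if n ∈ xs then xs.idxOf n else n + xs.length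

/-- The renaming `f`, moved under `k` binders. -/
def liftRenaming (k : ℕ) (f : ℕ → ℕ) (i : ℕ) : ℕ :=
  if i < k then i else f (i - k) + k

/-! ### Concurrent pattern calculus (CPC), with the success process -/

namespace CPC

/-- Communicable patterns: those without protected and binding names. -/
inductive Comm : Type
  | name (n : ℕ)
  | comp (c d : Comm)

/-- Patterns.  The binding names are anonymous: the `i`-th occurrence of `bind`, from the left and
counted from `0`, binds the index `i` in the body of the case.  So the binding names of a pattern
are automatically distinct from each other and from its free names. -/
inductive Pat : Type
  | bind
  | var (n : ℕ)
  | prot (n : ℕ)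
  | comp (p q : Pat)

namespace Comm

/-- A communicable pattern as a pattern. -/
def toPat : Comm → Pat
  | name n => .var n
  | comp c d => .comp c.toPat d.toPat

/-- Protection, extended from names to communicable patterns. -/
def protect : Comm → Pat
  | name n => .prot n
  | comp c d => .comp c.protect d.protect

/-- Renaming of names. -/
def rename (f : ℕ → ℕ) : Comm → Comm
  | name n => name (f n)
  | comp c d => comp (c.rename f) (d.rename f)

end Comm

namespace Pat

/-- The number of binding names of a pattern. -/
def binders : Pat → ℕ
  | bind => 1
  | var _ => 0
  | prot _ => 0
  | comp p q => p.binders + q.binders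

/-- The protected names of a pattern. -/
def pn : Pat → Set ℕ
  | bind => ∅
  | var _ => ∅
  | prot n => {n}
  | comp p q => p.pn ∪ q.pn

/-- The free names (variable names and protected names) of a pattern. -/
def fn : Pat → Set ℕ
  | bind => ∅
  | var n => {n}
  | prot n => {n}
  | comp p q => p.fn ∪ q.fn

/-- Application of a substitution to (the free names of) a pattern. -/
def subst (f : ℕ → Comm) : Pat → Pat
  | bind => bind
  | var n => (f n).toPat
  | prot n => (f n).protect
  | comp p q => comp (p.subst f) (q.subst f)

end Pat

/-- Unification of patterns: `Unify p q σ ρ` says that `{p || q} = (σ, ρ)`, where a substitution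
whose domain is the set of binding names of a pattern is given by the list of its values. -/
inductive Unify : Pat → Pat → List Comm → List Comm → Prop
  | var_var (n : ℕ) : Unify (.var n) (.var n) [] []
  | var_prot (n : ℕ) : Unify (.var n) (.prot n) [] []
  | prot_var (n : ℕ) : Unify (.prot n) (.var n) [] []
  | prot_prot (n : ℕ) : Unify (.prot n) (.prot n) [] []
  | bind_left (q : Pat) (c : Comm) (h : q = c.toPat) : Unify .bind q [c] []
  | bind_right (p : Pat) (c : Comm) (h : p = c.toPat) : Unify p .bind [] [c]
  | comp {p₁ p₂ q₁ q₂ : Pat} {σ₁ σ₂ ρ₁ ρ₂ : List Comm} :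
      Unify p₁ q₁ σ₁ ρ₁ → Unify p₂ q₂ σ₂ ρ₂ →
        Unify (.comp p₁ p₂) (.comp q₁ q₂) (σ₁ ++ σ₂) (ρ₁ ++ ρ₂)

/-- Processes: null, success, parallel composition, replication, restriction (binding the index `0`
in its body) and case (its pattern binds the indices `0, ..., p.binders - 1` in its body). -/
inductive Proc : Type
  | nil
  | ok
  | par (P Q : Proc)
  | repl (P : Proc)
  | res (P : Proc)
  | case (p : Pat) (P : Proc)

/-- The substitution `f`, moved under `k` binders. -/
def liftSubst (k : ℕ) (f : ℕ → Comm) (i : ℕ) : Comm :=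
  if i < k then .name i else (f (i - k)).rename (· + k)

/-- The substitution that replaces the bound indices `0, ..., σ.length - 1` by the values in `σ` and
removes their binders. -/
def inst (σ : List Comm) (i : ℕ) : Comm :=
  σ.getD i (.name (i - σ.length))

namespace Proc

/-- Capture-avoiding substitution. -/
def subst (f : ℕ → Comm) : Proc → Proc
  | nil => nil
  | ok => ok
  | par P Q => par (P.subst f) (Q.subst f)
  | repl P => repl (P.subst f)
  | res P => res (P.subst (liftSubst 1 f))
  | case p P => case (p.subst f) (P.subst (liftSubst p.binders f))

/-- Substitution of names for names. -/
def rename (f : ℕ → ℕ) (P : Proc) : Proc :=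
  P.subst fun n => .name (f n)

end Proc

/-- Structural congruence. -/
inductive Cong : Proc → Proc → Prop
  | par_nil (P : Proc) : Cong (.par P .nil) P
  | par_comm (P Q : Proc) : Cong (.par P Q) (.par Q P)
  | par_assoc (P Q R : Proc) : Cong (.par P (.par Q R)) (.par (.par P Q) R)
  | res_nil : Cong (.res .nil) .nil
  | res_res (P : Proc) : Cong (.res (.res P)) (.res (.res (P.rename (Equiv.swap 0 1))))
  | repl_unfold (P : Proc) : Cong (.repl P) (.par P (.repl P))
  | par_res (P Q : Proc) : Cong (.par P (.res Q)) (.res (.par (P.rename (· + 1)) Q))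
  | refl (P : Proc) : Cong P P
  | symm {P Q : Proc} : Cong P Q → Cong Q P
  | trans {P Q R : Proc} : Cong P Q → Cong Q R → Cong P R
  | par {P P' Q Q' : Proc} : Cong P P' → Cong Q Q' → Cong (.par P Q) (.par P' Q')
  | repl {P P' : Proc} : Cong P P' → Cong (.repl P) (.repl P')
  | res {P P' : Proc} : Cong P P' → Cong (.res P) (.res P')
  | case (p : Pat) {P P' : Proc} : Cong P P' → Cong (.case p P) (.case p P')

/-- Reduction. -/
inductive Red : Proc → Proc → Prop
  | unify {p q : Pat} {σ ρ : List Comm} (P Q : Proc) : Unify p q σ ρ →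
      Red (.par (.case p P) (.case q Q)) (.par (P.subst (inst σ)) (Q.subst (inst ρ)))
  | par {P P' : Proc} (Q : Proc) : Red P P' → Red (.par P Q) (.par P' Q)
  | res {P P' : Proc} : Red P P' → Red (.res P) (.res P')
  | struct {P Q Q' P' : Proc} : Cong P Q → Red Q Q' → Cong Q' P' → Red P P'

/-- `P` can reduce to a process with an unguarded success process. -/
def Succeeds (P : Proc) : Prop :=
  ∃ P' P'', Relation.ReflTransGen Red P P' ∧ Cong P' (.par P'' .ok)

/-- `P` has an infinite sequence of reductions. -/
def Diverges (P : Proc) : Prop :=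
  ∃ f : ℕ → Proc, f 0 = P ∧ ∀ i, Red (f i) (f (i + 1))

/-- `P` exhibits the barb `m`: it is structurally congruent to a process `(ν ns)(p → P' | P'')`
with no protected name of `p` in `ns` and with `m = fn(p) \ ns`.  Here `ns` consists of `k` names,
which are the indices below `k`. -/
def Barb (P : Proc) (m : Set ℕ) : Prop :=
  ∃ (k : ℕ) (p : Pat) (P' P'' : Proc),
    Cong P (Proc.res^[k] (.par (.case p P') P'')) ∧ (∀ i ∈ p.pn, k ≤ i) ∧ m = {i | i + k ∈ p.fn}

/-- Terms with numbered holes and with chosen names for their binders; these names bind in what is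
put into the holes.  `case p xs _ C` is a case with the pattern `p` whose binding names, from left
to right, are called `xs` in the body `C` (the names in `p` itself lie outside their scope). -/
inductive Ctx : Type
  | hole (i : ℕ)
  | nil
  | ok
  | par (C D : Ctx)
  | repl (C : Ctx)
  | res (x : ℕ) (C : Ctx)
  | case (p : Pat) (xs : List ℕ) (h : xs.Nodup ∧ xs.length = p.binders) (C : Ctx)

namespace Ctx

/-- The holes of a term with holes, with multiplicity. -/
def holes : Ctx → Multiset ℕ
  | hole i => {i}
  | nil => 0
  | ok => 0
  | par C D => C.holes + D.holes
  | repl C => C.holes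
  | res _ C => C.holes
  | case _ _ _ C => C.holes

/-- `k`-ary contexts: each of the holes `0, ..., k - 1` occurs exactly once. -/
def IsContext (k : ℕ) (C : Ctx) : Prop :=
  C.holes = Multiset.range k

/-- Put processes literally into the holes; the binders of the context may capture their names. -/
def plug (S : ℕ → Proc) : Ctx → Proc
  | hole i => S i
  | nil => .nil
  | ok => .ok
  | par C D => .par (C.plug S) (D.plug S)
  | repl C => .repl (C.plug S)
  | res x C => .res ((C.plug S).rename (closeNames [x]))
  | case p xs _ C => .case p ((C.plug S).rename (closeNames xs))

end Ctx

/-- Barb preserving relations. -/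
def BarbPreserving (R : Proc → Proc → Prop) : Prop :=
  ∀ P Q m, R P Q → Barb P m → Barb Q m

/-- Reduction closed relations. -/
def ReductionClosed (R : Proc → Proc → Prop) : Prop :=
  ∀ P Q P', R P Q → Red P P' → ∃ Q', Red Q Q' ∧ R P' Q'

/-- Context closed relations. -/
def ContextClosed (R : Proc → Proc → Prop) : Prop :=
  ∀ P Q C, R P Q → Ctx.IsContext 1 C → R (C.plug fun _ => P) (C.plug fun _ => Q)

/-- Barbed congruence: the largest relation that is symmetric, barb preserving, reduction closed and
context closed. -/
def BarbedCong (P Q : Proc) : Prop :=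
  ∃ R : Proc → Proc → Prop,
    (∀ P Q, R P Q → R Q P) ∧ BarbPreserving R ∧ ReductionClosed R ∧ ContextClosed R ∧ R P Q

end CPC

/-! ### Spi calculus, with the success process -/

namespace Spi

/-- Terms.  A numeral `i > 0` is the `i`-th successor of zero.  Variables are names. -/
inductive Term : Type
  | name (n : ℕ)
  | pair (M N : Term)
  | zero
  | suc (M : Term)
  /-- The encryption of `M` under the key `N`. -/
  | encr (M N : Term)

namespace Term

/-- Substitution of terms for names. -/
def subst (f : ℕ → Term) : Term → Term
  | name n => f n
  | pair M N => pair (M.subst f) (N.subst f)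
  | zero => zero
  | suc M => suc (M.subst f)
  | encr M N => encr (M.subst f) (N.subst f)

/-- Substitution of names for names. -/
def rename (f : ℕ → ℕ) (M : Term) : Term :=
  M.subst fun n => name (f n)

/-- The names of a term. -/
def fn : Term → Set ℕ
  | name n => {n}
  | pair M N => M.fn ∪ N.fn
  | zero => ∅
  | suc M => M.fn
  | encr M N => M.fn ∪ N.fn

end Term

/-- Processes. -/
inductive Proc : Type
  | nil
  | ok
  | par (P Q : Proc)
  | repl (P : Proc)
  /-- Restriction; binds the index `0` in `P`. -/
  | res (P : Proc)
  /-- Input `M(x).P`; `x` is the index `0` in `P`. -/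
  | inp (M : Term) (P : Proc)
  /-- Output of `N` on `M`, then `P`. -/
  | out (M N : Term) (P : Proc)
  /-- The match `[M is N] P`. -/
  | test (M N : Term) (P : Proc)
  /-- The splitting `let (x, y) = M in P`; `x` and `y` are the indices `0` and `1` in `P`. -/
  | split (M : Term) (P : Proc)
  /-- The decryption `case M of {x}_N : P`; `x` is the index `0` in `P`. -/
  | decrypt (M N : Term) (P : Proc)
  /-- The integer test `case M of 0 : P suc(x) : Q`; `x` is the index `0` in `Q`. -/
  | intCase (M : Term) (P Q : Proc)

/-- The substitution `f`, moved under `k` binders. -/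
def liftSubst (k : ℕ) (f : ℕ → Term) (i : ℕ) : Term :=
  if i < k then .name i else (f (i - k)).rename (· + k)

/-- The substitution that replaces the bound indices `0, ..., σ.length - 1` by the values in `σ` and
removes their binders. -/
def inst (σ : List Term) (i : ℕ) : Term :=
  σ.getD i (.name (i - σ.length))

namespace Proc

/-- Capture-avoiding substitution. -/
def subst (f : ℕ → Term) : Proc → Proc
  | nil => nil
  | ok => ok
  | par P Q => par (P.subst f) (Q.subst f)
  | repl P => repl (P.subst f)
  | res P => res (P.subst (liftSubst 1 f))
  | inp M P => inp (M.subst f) (P.subst (liftSubst 1 f))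
  | out M N P => out (M.subst f) (N.subst f) (P.subst f)
  | test M N P => test (M.subst f) (N.subst f) (P.subst f)
  | split M P => split (M.subst f) (P.subst (liftSubst 2 f))
  | decrypt M N P => decrypt (M.subst f) (N.subst f) (P.subst (liftSubst 1 f))
  | intCase M P Q => intCase (M.subst f) (P.subst f) (Q.subst (liftSubst 1 f))

/-- Substitution of names for names. -/
def rename (f : ℕ → ℕ) (P : Proc) : Proc :=
  P.subst fun n => .name (f n)

/-- The free names of a process. -/
def fn : Proc → Set ℕ
  | nil => ∅
  | ok => ∅
  | par P Q => P.fn ∪ Q.fn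
  | repl P => P.fn
  | res P => {n | n + 1 ∈ P.fn}
  | inp M P => M.fn ∪ {n | n + 1 ∈ P.fn}
  | out M N P => M.fn ∪ N.fn ∪ P.fn
  | test M N P => M.fn ∪ N.fn ∪ P.fn
  | split M P => M.fn ∪ {n | n + 2 ∈ P.fn}
  | decrypt M N P => M.fn ∪ N.fn ∪ {n | n + 1 ∈ P.fn}
  | intCase M P Q => M.fn ∪ P.fn ∪ {n | n + 1 ∈ Q.fn}

end Proc

/-- Structural congruence. -/
inductive Cong : Proc → Proc → Prop
  | par_nil (P : Proc) : Cong (.par P .nil) P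
  | par_comm (P Q : Proc) : Cong (.par P Q) (.par Q P)
  | par_assoc (P Q R : Proc) : Cong (.par P (.par Q R)) (.par (.par P Q) R)
  | res_nil : Cong (.res .nil) .nil
  | res_res (P : Proc) : Cong (.res (.res P)) (.res (.res (P.rename (Equiv.swap 0 1))))
  | repl_unfold (P : Proc) : Cong (.repl P) (.par P (.repl P))
  | par_res (P Q : Proc) : Cong (.par P (.res Q)) (.res (.par (P.rename (· + 1)) Q))
  | refl (P : Proc) : Cong P P
  | symm {P Q : Proc} : Cong P Q → Cong Q P
  | trans {P Q R : Proc} : Cong P Q → Cong Q R → Cong P R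
  | par {P P' Q Q' : Proc} : Cong P P' → Cong Q Q' → Cong (.par P Q) (.par P' Q')
  | repl {P P' : Proc} : Cong P P' → Cong (.repl P) (.repl P')
  | res {P P' : Proc} : Cong P P' → Cong (.res P) (.res P')
  | inp (M : Term) {P P' : Proc} : Cong P P' → Cong (.inp M P) (.inp M P')
  | out (M N : Term) {P P' : Proc} : Cong P P' → Cong (.out M N P) (.out M N P')
  | test (M N : Term) {P P' : Proc} : Cong P P' → Cong (.test M N P) (.test M N P')
  | split (M : Term) {P P' : Proc} : Cong P P' → Cong (.split M P) (.split M P')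
  | decrypt (M N : Term) {P P' : Proc} : Cong P P' → Cong (.decrypt M N P) (.decrypt M N P')
  | intCase (M : Term) {P P' Q Q' : Proc} : Cong P P' → Cong Q Q' →
      Cong (.intCase M P Q) (.intCase M P' Q')

/-- Reduction. -/
inductive Red : Proc → Proc → Prop
  | comm (M N : Term) (P Q : Proc) :
      Red (.par (.out M N P) (.inp M Q)) (.par P (Q.subst (inst [N])))
  | test (M : Term) (P : Proc) : Red (.test M M P) P
  | split (M N : Term) (P : Proc) : Red (.split (.pair M N) P) (P.subst (inst [M, N]))
  | decrypt (M N : Term) (P : Proc) : Red (.decrypt (.encr M N) N P) (P.subst (inst [M]))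
  | intCase_zero (P Q : Proc) : Red (.intCase .zero P Q) P
  | intCase_suc (N : Term) (P Q : Proc) : Red (.intCase (.suc N) P Q) (Q.subst (inst [N]))
  | par {P P' : Proc} (Q : Proc) : Red P P' → Red (.par P Q) (.par P' Q)
  | res {P P' : Proc} : Red P P' → Red (.res P) (.res P')
  | struct {P Q Q' P' : Proc} : Cong P Q → Red Q Q' → Cong Q' P' → Red P P'

/-- `P` can reduce to a process with an unguarded success process. -/
def Succeeds (P : Proc) : Prop :=
  ∃ P' P'', Relation.ReflTransGen Red P P' ∧ Cong P' (.par P'' .ok)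

/-- `P` has an infinite sequence of reductions. -/
def Diverges (P : Proc) : Prop :=
  ∃ f : ℕ → Proc, f 0 = P ∧ ∀ i, Red (f i) (f (i + 1))

/-- The operators of the calculus, with their terms and with names for their binders. -/
inductive Op : Type
  | nil
  | ok
  | par
  | repl
  | res (m : ℕ)
  | inp (M : Term) (x : ℕ)
  | out (M N : Term)
  | test (M N : Term)
  | split (x y : ℕ) (h : x ≠ y) (M : Term)
  | decrypt (M : Term) (x : ℕ) (N : Term)
  | intCase (M : Term) (x : ℕ)

namespace Op

/-- The number of process arguments of an operator. -/
def arity : Op → ℕ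
  | nil => 0
  | ok => 0
  | par => 2
  | repl => 1
  | res _ => 1
  | inp _ _ => 1
  | out _ _ => 1
  | test _ _ => 1
  | split _ _ _ _ => 1
  | decrypt _ _ _ => 1
  | intCase _ _ => 2

/-- Application of an operator `op` to the arguments `S 0, ..., S (op.arity - 1)`. -/
def apply (S : ℕ → Proc) : Op → Proc
  | nil => .nil
  | ok => .ok
  | par => .par (S 0) (S 1)
  | repl => .repl (S 0)
  | res m => .res ((S 0).rename (closeNames [m]))
  | inp M x => .inp M ((S 0).rename (closeNames [x]))
  | out M N => .out M N (S 0)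
  | test M N => .test M N (S 0)
  | split x y _ M => .split M ((S 0).rename (closeNames [x, y]))
  | decrypt M x N => .decrypt M N ((S 0).rename (closeNames [x]))
  | intCase M x => .intCase M (S 0) ((S 1).rename (closeNames [x]))

end Op

end Spi

/-! ### Valid encodings of Spi calculus into CPC -/

/-- The translation `enc` with the renaming policy `φ`, which maps every Spi name to a tuple of `k`
CPC names, is a valid encoding. -/
structure IsValidEncoding (enc : Spi.Proc → CPC.Proc) {k : ℕ} (φ : ℕ → Fin k → ℕ) : Prop where
  tuple_pos : 0 < k
  compositionality : ∀ (op : Spi.Op) (N : Set ℕ), ∃ C : CPC.Ctx, C.IsContext op.arity ∧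
    ∀ S : ℕ → Spi.Proc, (⋃ i < op.arity, (S i).fn) = N →
      enc (op.apply S) = C.plug fun i => enc (S i)
  /-- `σ'` is the substitution of CPC names that corresponds to `σ` through the renaming policy; it
  does not touch the names that the renaming policy does not use. -/
  name_invariance : ∀ σ : ℕ → ℕ, ∃ σ' : ℕ → ℕ,
    (∀ a j, φ (σ a) j = σ' (φ a j)) ∧ (∀ c, (∀ a j, φ a j ≠ c) → σ' c = c) ∧
    ∀ S : Spi.Proc,
      (Function.Injective σ → enc (S.rename σ) = (enc S).rename σ') ∧
      (¬ Function.Injective σ → CPC.BarbedCong (enc (S.rename σ)) ((enc S).rename σ'))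
  operational_completeness : ∀ S S' : Spi.Proc, Relation.ReflTransGen Spi.Red S S' →
    ∃ T, Relation.ReflTransGen CPC.Red (enc S) T ∧ CPC.BarbedCong T (enc S')
  operational_soundness : ∀ (S : Spi.Proc) (T : CPC.Proc),
    Relation.ReflTransGen CPC.Red (enc S) T →
      ∃ (S' : Spi.Proc) (T' : CPC.Proc), Relation.ReflTransGen Spi.Red S S' ∧
        Relation.ReflTransGen CPC.Red T T' ∧ CPC.BarbedCong T' (enc S')
  divergence_reflection : ∀ S : Spi.Proc, CPC.Diverges (enc S) → Spi.Diverges S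
  success_sensitiveness : ∀ S : Spi.Proc, Spi.Succeeds S ↔ CPC.Succeeds (enc S)

/-! ### The encoding -/

/-- The reserved names used by the encoding. -/
inductive Tag : Type
  | pair
  | encr
  | zero
  | suc
  | input

namespace Spi

/-- The encoding of terms; `ι` gives the CPC names that stand for the Spi names and `τ` the CPC
names that are the reserved names. -/
def Term.encode (ι : ℕ → ℕ) (τ : Tag → ℕ) : Term → CPC.Comm
  | name n => .name (ι n)
  | pair M N => .comp (.comp (.name (τ .pair)) (M.encode ι τ)) (N.encode ι τ)
  | zero => .name (τ .zero)
  | suc M => .comp (.name (τ .suc)) (M.encode ι τ)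
  | encr M N => .comp (.comp (.name (τ .encr)) (M.encode ι τ)) (N.encode ι τ)

/-- The encoding of processes.  When it goes under `k` binders of CPC that do not bind anything in
the Spi process, the maps `ι` and `τ` are followed by `(· + k)`; for binders that bind in the Spi
process too, `ι` becomes `liftRenaming k ι`.

In the last four clauses the restriction introduces the fresh name `n`, which is the index `0` just
below it, and `ι₁` and `τ₁` are the maps for the scope of this restriction. -/
def Proc.encode (ι : ℕ → ℕ) (τ : Tag → ℕ) : Spi.Proc → CPC.Proc
  | .nil => .nil
  | .ok => .ok
  | .par P Q => .par (P.encode ι τ) (Q.encode ι τ)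
  | .repl P => .repl (P.encode ι τ)
  | .res P => .res (P.encode (liftRenaming 1 ι) (τ · + 1))
  | .inp M P =>
      .case (.comp (.comp (M.encode ι τ).toPat .bind) (.var (τ .input)))
        (P.encode (liftRenaming 1 ι) (τ · + 1))
  | .out M N P =>
      .case (.comp (.comp (M.encode ι τ).toPat (N.encode ι τ).toPat) .bind)
        (P.encode (ι · + 1) (τ · + 1))
  | .test M N P =>
      let ι₁ : ℕ → ℕ := (ι · + 1)
      let τ₁ : Tag → ℕ := (τ · + 1)
      .res (.par
        (.case (.comp (.prot 0) (M.encode ι₁ τ₁).toPat) (P.encode ι₁ τ₁))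
        (.case (.comp (.prot 0) (N.encode ι₁ τ₁).toPat) .nil))
  | .split M P =>
      let ι₁ : ℕ → ℕ := (ι · + 1)
      let τ₁ : Tag → ℕ := (τ · + 1)
      .res (.par
        (.case (.comp (.prot 0) (.comp (.comp (.prot (τ₁ .pair)) .bind) .bind))
          (P.encode (liftRenaming 2 ι₁) (τ₁ · + 2)))
        (.case (.comp (.prot 0) (M.encode ι₁ τ₁).toPat) .nil))
  | .decrypt M N P =>
      let ι₁ : ℕ → ℕ := (ι · + 1)
      let τ₁ : Tag → ℕ := (τ · + 1)
      .res (.par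
        (.case (.comp (.prot 0) (.comp (.comp (.prot (τ₁ .encr)) .bind) (N.encode ι₁ τ₁).toPat))
          (P.encode (liftRenaming 1 ι₁) (τ₁ · + 1)))
        (.case (.comp (.prot 0) (M.encode ι₁ τ₁).toPat) .nil))
  | .intCase M P Q =>
      let ι₁ : ℕ → ℕ := (ι · + 1)
      let τ₁ : Tag → ℕ := (τ · + 1)
      .res (.par
        (.case (.comp (.prot 0) (.prot (τ₁ .zero))) (P.encode ι₁ τ₁))
        (.par
          (.case (.comp (.prot 0) (.comp (.prot (τ₁ .suc)) .bind))
            (Q.encode (liftRenaming 1 ι₁) (τ₁ · + 1)))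
          (.case (.comp (.prot 0) (M.encode ι₁ τ₁).toPat) .nil)))

end Spi

/-! The encoding answers each Spi reduction by exactly one CPC reduction and conversely, and the two
results agree up to structural congruence in every case but one. When an integer case fires, the
branch not taken stays behind as `(ν n)(⌜n⌝ • p → R)`. Such a case is inert: its pattern protects a
private name that nothing else knows. The proof therefore works with `GCong True`, structural
congruence plus the law that erases such blocked cases. This relation is symmetric, closed under
contexts, and preserves barbs and reductions (`GCong.plug`, `GCong.barb`, `GCong.red`), so it is
contained in barbed congruence (`GCong.barbedCong`).

Reductions are closed under structural congruence, which obstructs inversion. They are replaced by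
`Step`, a relation defined along the syntax. Its communications come from `Interact`: one process
exposes a thread, and the other exposes a case that reacts with it. Barbs, success and both sides of
a communication are all instances of one predicate `Expose`; a base relation that is `Natural` gives
an exposure compatible with `GCong` (`Natural.expose_gcong`). The laws of `GCong` are then checked
against `Step` once (`Step.gcong_aux`), for structural congruence (`GCong False`) and its extension
together.

On encodings, `exists_of_expose_encode` says that only inputs, outputs and success are visible from
outside, since every other clause hides behind a protected private name. Inputs meet only outputs,
because two binding names never unify, and unification of encoded terms is equality, because the
term encoding is injective. With the substitution lemma `Proc.encode_subst` this gives the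
correspondence `exists_red_of_red_encode` and `Red.exists_red_encode`. Operational correspondence,
divergence reflection and success sensitiveness follow, as `GCong True` can be carried along
reduction sequences. Name invariance is again the substitution lemma, and compositionality needs
only a name fresh for the finite set of names involved. -/

/-! ### Renamings under binders. -/

theorem liftRenaming_lt {k i : ℕ} (f : ℕ → ℕ) (h : i < k) : liftRenaming k f i = i := if_pos h

@[simp]
theorem liftRenaming_add (k i : ℕ) (f : ℕ → ℕ) : liftRenaming k f (i + k) = f i + k := by
  simp [liftRenaming]

theorem liftRenaming_zero (f : ℕ → ℕ) : liftRenaming 0 f = f := by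
  funext i; simp [liftRenaming]

theorem liftRenaming_liftRenaming (k l : ℕ) (f : ℕ → ℕ) :
    liftRenaming k (liftRenaming l f) = liftRenaming (k + l) f := by
  funext i
  simp only [liftRenaming]
  split_ifs <;> first | omega | (rw [show i - k - l = i - (k + l) by omega]; omega)

theorem liftRenaming_injective {f : ℕ → ℕ} (k : ℕ) (hf : Function.Injective f) :
    Function.Injective (liftRenaming k f) := by
  intro i j h
  simp only [liftRenaming] at h
  split_ifs at h with h1 h2 h2
  · exact h
  · omega
  · omega
  · have := hf (Nat.add_right_cancel h); omega

theorem liftRenaming_comp_add (k : ℕ) (f : ℕ → ℕ) : liftRenaming k f ∘ (· + k) = (· + k) ∘ f := by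
  funext i; simp

/-- An index of the outer scope is in the range of `f` if it is in that of the lifted `f`. -/
theorem add_notMem_range_liftRenaming {f : ℕ → ℕ} {i : ℕ} (k : ℕ) (h : i ∉ Set.range f) :
    i + k ∉ Set.range (liftRenaming k f) := by
  rintro ⟨j, hj⟩
  simp only [liftRenaming] at hj
  split_ifs at hj with h1
  · omega
  · exact h ⟨_, Nat.add_right_cancel hj⟩

theorem swap_zero_one_involutive : Function.Involutive (Equiv.swap (0 : ℕ) 1) :=
  fun _ => Equiv.swap_apply_self _ _ _

theorem swap_zero_one_add_two (i : ℕ) : Equiv.swap (0 : ℕ) 1 (i + 2) = i + 2 :=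
  Equiv.swap_apply_of_ne_of_ne (by omega) (by omega)

namespace CPC

/-! ### Substitution in CPC -/

namespace Comm

/-- Application of a substitution to a communicable pattern. -/
def subst (f : ℕ → Comm) : Comm → Comm
  | name n => f n
  | comp c d => comp (c.subst f) (d.subst f)

theorem rename_eq_subst (f : ℕ → ℕ) (c : Comm) : c.rename f = c.subst fun n => name (f n) := by
  induction c with
  | name n => rfl
  | comp c d hc hd => simp [rename, subst, hc, hd]

theorem subst_subst (f g : ℕ → Comm) (c : Comm) :
    (c.subst f).subst g = c.subst fun i => (f i).subst g := by
  induction c with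
  | name n => rfl
  | comp c d hc hd => simp [subst, hc, hd]

theorem subst_name (c : Comm) : c.subst name = c := by
  induction c with
  | name n => rfl
  | comp c d hc hd => simp [subst, hc, hd]

theorem subst_toPat (f : ℕ → Comm) (c : Comm) : c.toPat.subst f = (c.subst f).toPat := by
  induction c with
  | name n => rfl
  | comp c d hc hd => simp [subst, toPat, Pat.subst, hc, hd]

theorem subst_protect (f : ℕ → Comm) (c : Comm) : c.protect.subst f = (c.subst f).protect := by
  induction c with
  | name n => rfl
  | comp c d hc hd => simp [subst, protect, Pat.subst, hc, hd]

@[simp]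
theorem binders_toPat (c : Comm) : c.toPat.binders = 0 := by
  induction c with
  | name n => rfl
  | comp c d hc hd => simp [toPat, Pat.binders, hc, hd]

@[simp]
theorem binders_protect (c : Comm) : c.protect.binders = 0 := by
  induction c with
  | name n => rfl
  | comp c d hc hd => simp [protect, Pat.binders, hc, hd]

theorem toPat_injective : Function.Injective toPat := by
  intro c
  induction c with
  | name n => intro d h; cases d <;> simp_all [toPat]
  | comp c d hc hd =>
    intro e h
    cases e with
    | name n => simp [toPat] at h
    | comp e e' =>
      simp only [toPat, Pat.comp.injEq] at h
      rw [hc h.1, hd h.2]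

end Comm

namespace Pat

@[simp]
theorem binders_subst (f : ℕ → Comm) (p : Pat) : (p.subst f).binders = p.binders := by
  induction p with
  | bind => rfl
  | var n => simp [subst, binders]
  | prot n => simp [subst, binders]
  | comp p q hp hq => simp [subst, binders, hp, hq]

theorem subst_subst (f g : ℕ → Comm) (p : Pat) :
    (p.subst f).subst g = p.subst fun i => (f i).subst g := by
  induction p with
  | bind => rfl
  | var n => exact Comm.subst_toPat g _
  | prot n => exact Comm.subst_protect g _
  | comp p q hp hq => simp [subst, hp, hq]

theorem subst_name (p : Pat) : p.subst Comm.name = p := by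
  induction p with
  | bind => rfl
  | var n => rfl
  | prot n => rfl
  | comp p q hp hq => simp [subst, hp, hq]

/-- Renaming of the free names of a pattern. -/
abbrev rename (f : ℕ → ℕ) (p : Pat) : Pat := p.subst fun n => .name (f n)

theorem fn_rename (f : ℕ → ℕ) (p : Pat) : (p.rename f).fn = f '' p.fn := by
  induction p with
  | bind => simp [rename, subst, fn]
  | var n => simp [rename, subst, fn, Comm.toPat]
  | prot n => simp [rename, subst, fn, Comm.protect]
  | comp p q hp hq => simp only [rename, subst, fn, Set.image_union] at *; rw [hp, hq]

theorem pn_rename (f : ℕ → ℕ) (p : Pat) : (p.rename f).pn = f '' p.pn := by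
  induction p with
  | bind => simp [rename, subst, pn]
  | var n => simp [rename, subst, pn, Comm.toPat]
  | prot n => simp [rename, subst, pn, Comm.protect]
  | comp p q hp hq => simp only [rename, subst, pn, Set.image_union] at *; rw [hp, hq]

theorem exists_of_rename_eq_toPat {f : ℕ → ℕ} {p : Pat} {c : Comm} (h : p.rename f = c.toPat) :
    ∃ d : Comm, p = d.toPat ∧ c = d.rename f := by
  induction p generalizing c with
  | bind => cases c <;> simp [rename, subst, Comm.toPat] at h
  | var n =>
    cases c with
    | name m => exact ⟨.name n, rfl, by simp_all [rename, subst, Comm.toPat, Comm.rename]⟩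
    | comp c d => simp [rename, subst, Comm.toPat] at h
  | prot n => cases c <;> simp [rename, subst, Comm.toPat, Comm.protect] at h
  | comp p q hp hq =>
    cases c with
    | name m => simp [rename, subst, Comm.toPat] at h
    | comp c d =>
      simp only [rename, subst, Comm.toPat, Pat.comp.injEq] at h
      obtain ⟨c', rfl, rfl⟩ := hp h.1
      obtain ⟨d', rfl, rfl⟩ := hq h.2
      exact ⟨.comp c' d', rfl, rfl⟩

end Pat

theorem liftSubst_lt {k i : ℕ} (f : ℕ → Comm) (h : i < k) : liftSubst k f i = .name i := if_pos h

@[simp]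
theorem liftSubst_add (k i : ℕ) (f : ℕ → Comm) : liftSubst k f (i + k) = (f i).rename (· + k) := by
  simp [liftSubst]

theorem liftSubst_name (k : ℕ) (f : ℕ → ℕ) :
    (liftSubst k fun n => .name (f n)) = fun n => .name (liftRenaming k f n) := by
  funext i
  simp only [liftSubst, liftRenaming]
  split_ifs <;> rfl

theorem liftSubst_id (k : ℕ) : liftSubst k Comm.name = Comm.name := by
  funext i
  simp only [liftSubst]
  split_ifs with h
  · rfl
  · simp only [Comm.rename]; congr 1; omega

theorem subst_liftSubst_liftSubst (k : ℕ) (f g : ℕ → Comm) :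
    (fun i => (liftSubst k f i).subst (liftSubst k g)) = liftSubst k fun i => (f i).subst g := by
  funext i
  rcases lt_or_ge i k with h | h
  · simp [liftSubst_lt _ h, Comm.subst]
  · obtain ⟨j, rfl⟩ := Nat.exists_eq_add_of_le' h
    simp [Comm.rename_eq_subst, Comm.subst_subst, Comm.subst]

namespace Proc

theorem subst_subst (f g : ℕ → Comm) (P : Proc) :
    (P.subst f).subst g = P.subst fun i => (f i).subst g := by
  induction P generalizing f g with
  | nil => rfl
  | ok => rfl
  | par P Q hP hQ => simp [subst, hP, hQ]
  | repl P hP => simp [subst, hP]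
  | res P hP => simp [subst, hP, subst_liftSubst_liftSubst]
  | case p P hP => simp [subst, hP, subst_liftSubst_liftSubst, Pat.subst_subst]

theorem subst_name (P : Proc) : P.subst Comm.name = P := by
  induction P with
  | nil => rfl
  | ok => rfl
  | par P Q hP hQ => simp [subst, hP, hQ]
  | repl P hP => simp [subst, hP]
  | res P hP => simp [subst, hP, liftSubst_id]
  | case p P hP => simp [subst, hP, liftSubst_id, Pat.subst_name]

@[simp]
theorem rename_nil (f : ℕ → ℕ) : nil.rename f = nil := rfl

@[simp]
theorem rename_ok (f : ℕ → ℕ) : ok.rename f = ok := rfl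

@[simp]
theorem rename_par (f : ℕ → ℕ) (P Q : Proc) :
    (par P Q).rename f = par (P.rename f) (Q.rename f) := rfl

@[simp]
theorem rename_repl (f : ℕ → ℕ) (P : Proc) : (repl P).rename f = repl (P.rename f) := rfl

@[simp]
theorem rename_res (f : ℕ → ℕ) (P : Proc) :
    (res P).rename f = res (P.rename (liftRenaming 1 f)) := by
  simp [rename, subst, liftSubst_name]

@[simp]
theorem rename_case (f : ℕ → ℕ) (p : Pat) (P : Proc) :
    (case p P).rename f = case (p.rename f) (P.rename (liftRenaming p.binders f)) := by
  simp [rename, subst, liftSubst_name]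

theorem rename_rename (f g : ℕ → ℕ) (P : Proc) : (P.rename f).rename g = P.rename (g ∘ f) := by
  simp only [rename, subst_subst]; rfl

theorem rename_id (P : Proc) : P.rename id = P := subst_name P

theorem subst_rename_add (k : ℕ) (f : ℕ → Comm) (P : Proc) :
    (P.rename (· + k)).subst (liftSubst k f) = (P.subst f).rename (· + k) := by
  simp only [rename, subst_subst]
  congr 1
  funext i
  simp [Comm.subst, Comm.rename_eq_subst]

theorem subst_rename_swap (f : ℕ → Comm) (P : Proc) :
    (P.rename (Equiv.swap 0 1)).subst (liftSubst 1 (liftSubst 1 f)) =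
      (P.subst (liftSubst 1 (liftSubst 1 f))).rename (Equiv.swap 0 1) := by
  simp only [rename, subst_subst]
  congr 1
  funext i
  rcases i with _ | _ | i
  · simp [Comm.subst, liftSubst, Comm.rename]
  · simp [Comm.subst, liftSubst, Comm.rename]
  · simp only [Comm.subst, swap_zero_one_add_two]
    rw [show i + 2 = i + 1 + 1 from rfl, liftSubst_add, liftSubst_add]
    simp only [Comm.rename_eq_subst, Comm.subst_subst, Comm.subst]
    exact congrArg (Comm.subst · _) (funext fun j => congrArg _ (swap_zero_one_add_two j).symm)

theorem rename_swap_rename_swap (P : Proc) :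
    (P.rename (Equiv.swap 0 1)).rename (Equiv.swap 0 1) = P := by
  rw [rename_rename, swap_zero_one_involutive.comp_self, rename_id]

/-- Instantiation commutes with renaming. -/
theorem rename_subst_inst (f : ℕ → ℕ) (σ : List Comm) (P : Proc) :
    (P.subst (inst σ)).rename f =
      (P.rename (liftRenaming σ.length f)).subst (inst (σ.map (Comm.rename f))) := by
  simp only [rename, subst_subst]
  congr 1
  funext i
  simp only [Comm.subst, inst, liftRenaming, List.length_map]
  split_ifs with h
  · simp [h, Comm.rename_eq_subst]
  · simp [not_lt.1 h, Comm.subst]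

end Proc

/-! ### Unification -/

namespace Unify

theorem symm {p q : Pat} {σ ρ : List Comm} (h : Unify p q σ ρ) : Unify q p ρ σ := by
  induction h with
  | var_var n => exact .var_var n
  | var_prot n => exact .prot_var n
  | prot_var n => exact .var_prot n
  | prot_prot n => exact .prot_prot n
  | bind_left q c h => exact .bind_right q c h
  | bind_right p c h => exact .bind_left p c h
  | comp _ _ h₁ h₂ => exact .comp h₁ h₂

theorem length_left {p q : Pat} {σ ρ : List Comm} (h : Unify p q σ ρ) : σ.length = p.binders := by
  induction h with
  | bind_right p c h => simp [h]
  | comp _ _ h₁ h₂ => simp [Pat.binders, h₁, h₂]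
  | _ => rfl

theorem length_right {p q : Pat} {σ ρ : List Comm} (h : Unify p q σ ρ) : ρ.length = q.binders :=
  h.symm.length_left

theorem rename (f : ℕ → ℕ) {p q : Pat} {σ ρ : List Comm} (h : Unify p q σ ρ) :
    Unify (p.rename f) (q.rename f) (σ.map (Comm.rename f)) (ρ.map (Comm.rename f)) := by
  induction h with
  | var_var n => exact .var_var _
  | var_prot n => exact .var_prot _
  | prot_var n => exact .prot_var _
  | prot_prot n => exact .prot_prot _
  | bind_left q c h =>
    exact .bind_left _ _ (by rw [h, Comm.rename_eq_subst]; exact Comm.subst_toPat _ _)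
  | bind_right p c h =>
    exact .bind_right _ _ (by rw [h, Comm.rename_eq_subst]; exact Comm.subst_toPat _ _)
  | comp _ _ h₁ h₂ => rw [List.map_append, List.map_append]; exact .comp h₁ h₂

/-- Injectivity enters only where two names are compared: distinct names must not be identified by
the renaming. -/
theorem of_rename {f : ℕ → ℕ} (hf : Function.Injective f) {p q : Pat} {σ' ρ' : List Comm}
    (h : Unify (p.rename f) (q.rename f) σ' ρ') :
    ∃ σ ρ, Unify p q σ ρ ∧ σ' = σ.map (Comm.rename f) ∧ ρ' = ρ.map (Comm.rename f) := by
  generalize hp : p.rename f = p' at h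
  generalize hq : q.rename f = q' at h
  induction h generalizing p q with
  | bind_left q' c h =>
    obtain ⟨d, rfl, rfl⟩ := Pat.exists_of_rename_eq_toPat (hq.trans h)
    cases p <;> simp [Pat.rename, Pat.subst, Comm.toPat, Comm.protect] at hp
    exact ⟨[d], [], .bind_left _ _ rfl, rfl, rfl⟩
  | bind_right p' c h =>
    obtain ⟨d, rfl, rfl⟩ := Pat.exists_of_rename_eq_toPat (hp.trans h)
    cases q <;> simp [Pat.rename, Pat.subst, Comm.toPat, Comm.protect] at hq
    exact ⟨[], [d], .bind_right _ _ rfl, rfl, rfl⟩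
  | comp _ _ h₁ h₂ =>
    cases p <;> simp [Pat.rename, Pat.subst, Comm.toPat, Comm.protect] at hp
    cases q <;> simp [Pat.rename, Pat.subst, Comm.toPat, Comm.protect] at hq
    obtain ⟨σ₁, ρ₁, h₁', rfl, rfl⟩ := h₁ hp.1 hq.1
    obtain ⟨σ₂, ρ₂, h₂', rfl, rfl⟩ := h₂ hp.2 hq.2
    exact ⟨_, _, .comp h₁' h₂', by simp, by simp⟩
  | _ n =>
    cases p <;> simp [Pat.rename, Pat.subst, Comm.toPat, Comm.protect] at hp
    cases q <;> simp [Pat.rename, Pat.subst, Comm.toPat, Comm.protect] at hq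
    obtain rfl := hf (hp.trans hq.symm)
    exact ⟨[], [], by constructor, rfl, rfl⟩

/-- A pattern without the name `i` does not unify with a compound whose first component protects
`i`. -/
theorem not_comp_prot {f : ℕ → ℕ} {i : ℕ} (hi : i ∉ Set.range f) {p q : Pat} {σ ρ : List Comm}
    (h : Unify (q.rename f) (.comp (.prot i) p) σ ρ) : False := by
  cases q with
  | bind =>
    cases h with
    | bind_left _ c h =>
      cases c with
      | name n => simp [Comm.toPat] at h
      | comp c d => cases c <;> simp [Comm.toPat] at h
  | var n => cases h
  | prot n => cases h
  | comp q q' =>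
    cases h with
    | comp h₁ h₂ =>
      cases q with
      | bind =>
        cases h₁ with
        | bind_left _ c h => cases c <;> simp [Comm.toPat] at h
      | var n => cases h₁; exact hi ⟨n, rfl⟩
      | prot n => cases h₁; exact hi ⟨n, rfl⟩
      | comp q q' => cases h₁

theorem toPat_iff {c d : Comm} {σ ρ : List Comm} :
    Unify c.toPat d.toPat σ ρ ↔ c = d ∧ σ = [] ∧ ρ = [] := by
  constructor
  · intro h
    induction c generalizing d σ ρ with
    | name n => cases d <;> cases h; simp
    | comp c c' hc hc' =>
      cases d with
      | name n => cases h
      | comp d d' =>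
        cases h with
        | comp h₁ h₂ =>
          obtain ⟨rfl, rfl, rfl⟩ := hc h₁
          obtain ⟨rfl, rfl, rfl⟩ := hc' h₂
          simp
  · rintro ⟨rfl, rfl, rfl⟩
    induction c with
    | name n => exact .var_var n
    | comp c d hc hd => exact .comp hc hd

end Unify

end CPC

namespace CPC

/-! ### Structural congruence with garbage collection -/

/-- Structural congruence, extended (if `g` holds) by the law that removes a case that is blocked
because its pattern protects a private name. -/
inductive GCong (g : Prop) : Proc → Proc → Prop
  | par_nil (P : Proc) : GCong g (.par P .nil) P
  | par_comm (P Q : Proc) : GCong g (.par P Q) (.par Q P)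
  | par_assoc (P Q R : Proc) : GCong g (.par P (.par Q R)) (.par (.par P Q) R)
  | res_nil : GCong g (.res .nil) .nil
  | res_res (P : Proc) : GCong g (.res (.res P)) (.res (.res (P.rename (Equiv.swap 0 1))))
  | repl_unfold (P : Proc) : GCong g (.repl P) (.par P (.repl P))
  | par_res (P Q : Proc) : GCong g (.par P (.res Q)) (.res (.par (P.rename (· + 1)) Q))
  | dead (hg : g) (p : Pat) (P : Proc) : GCong g (.res (.case (.comp (.prot 0) p) P)) .nil
  | refl (P : Proc) : GCong g P P
  | symm {P Q : Proc} : GCong g P Q → GCong g Q P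
  | trans {P Q R : Proc} : GCong g P Q → GCong g Q R → GCong g P R
  | par {P P' Q Q' : Proc} : GCong g P P' → GCong g Q Q' → GCong g (.par P Q) (.par P' Q')
  | repl {P P' : Proc} : GCong g P P' → GCong g (.repl P) (.repl P')
  | res {P P' : Proc} : GCong g P P' → GCong g (.res P) (.res P')
  | case (p : Pat) {P P' : Proc} : GCong g P P' → GCong g (.case p P) (.case p P')

theorem Cong.gcong {P Q : Proc} (g : Prop) (h : Cong P Q) : GCong g P Q := by
  induction h with
  | trans _ _ h₁ h₂ => exact h₁.trans h₂
  | symm _ h => exact h.symm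
  | par _ _ h₁ h₂ => exact h₁.par h₂
  | repl _ h => exact h.repl
  | res _ h => exact h.res
  | case p _ h => exact h.case p
  | _ => constructor

/-- With `g = False` the erasing law has no instances. Every result proved for arbitrary `g` thus
covers plain structural congruence as well. -/
theorem GCong.cong {P Q : Proc} (h : GCong False P Q) : Cong P Q := by
  induction h with
  | trans _ _ h₁ h₂ => exact h₁.trans h₂
  | symm _ h => exact h.symm
  | par _ _ h₁ h₂ => exact h₁.par h₂
  | repl _ h => exact h.repl
  | res _ h => exact h.res
  | case p _ h => exact h.case p
  | dead hg => exact hg.elim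
  | _ => constructor

theorem GCong.subst {g : Prop} {P Q : Proc} (h : GCong g P Q) (f : ℕ → Comm) :
    GCong g (P.subst f) (Q.subst f) := by
  induction h generalizing f with
  | trans _ _ h₁ h₂ => exact (h₁ f).trans (h₂ f)
  | symm _ h => exact (h f).symm
  | par _ _ h₁ h₂ => exact (h₁ f).par (h₂ f)
  | repl _ h => exact (h f).repl
  | res _ h => exact (h _).res
  | case p _ h => exact (h _).case _
  | res_res P => simpa only [Proc.subst, Proc.subst_rename_swap] using GCong.res_res _
  | par_res P Q => simpa only [Proc.subst, Proc.subst_rename_add] using GCong.par_res _ _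
  -- A substitution moved under the restriction fixes the index `0`, so the pattern still protects
  -- the private name.
  | dead hg p P => exact .dead hg _ _
  | par_nil P => exact .par_nil _
  | par_comm P Q => exact .par_comm _ _
  | par_assoc P Q R => exact .par_assoc _ _ _
  | res_nil => exact .res_nil
  | repl_unfold P => exact .repl_unfold _
  | refl P => exact .refl _

theorem GCong.rename {g : Prop} {P Q : Proc} (h : GCong g P Q) (f : ℕ → ℕ) :
    GCong g (P.rename f) (Q.rename f) := h.subst _

/-- The setoid of `GCong`. -/
def gcongSetoid (g : Prop) : Setoid Proc := ⟨GCong g, .refl, .symm, .trans⟩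

/-- Processes up to `GCong`. -/
def GClass (g : Prop) : Type := Quotient (gcongSetoid g)

/-- The class of a process. -/
def cls (g : Prop) (P : Proc) : GClass g := Quotient.mk (gcongSetoid g) P

theorem cls_eq {g : Prop} {P Q : Proc} : cls g P = cls g Q ↔ GCong g P Q :=
  ⟨fun h => Quotient.exact (s := gcongSetoid g) h, fun h => Quotient.sound (s := gcongSetoid g) h⟩

theorem GCong.eq {g : Prop} {P Q : Proc} (h : GCong g P Q) : cls g P = cls g Q := cls_eq.2 h

/-- Restriction on classes. -/
def GClass.res {g : Prop} : GClass g → GClass g :=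
  Quotient.map' (s₁ := gcongSetoid g) (s₂ := gcongSetoid g) Proc.res fun _ _ h => h.res

/-- Replication on classes. -/
def GClass.repl {g : Prop} : GClass g → GClass g :=
  Quotient.map' (s₁ := gcongSetoid g) (s₂ := gcongSetoid g) Proc.repl fun _ _ h => h.repl

/-- Turns rearrangements of parallel compositions into monoid identities that `simp` and `ac_rfl`
can prove. -/
instance (g : Prop) : CommMonoid (GClass g) where
  mul := Quotient.map₂ (sa := gcongSetoid g) (sb := gcongSetoid g) (sc := gcongSetoid g) Proc.par
    fun _ _ h _ _ h' => h.par h'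
  one := cls g .nil
  mul_assoc := by rintro ⟨P⟩ ⟨Q⟩ ⟨R⟩; exact (GCong.par_assoc P Q R).symm.eq
  one_mul := by rintro ⟨P⟩; exact ((GCong.par_comm _ _).trans (GCong.par_nil P)).eq
  mul_one := by rintro ⟨P⟩; exact (GCong.par_nil P).eq
  mul_comm := by rintro ⟨P⟩ ⟨Q⟩; exact (GCong.par_comm P Q).eq

variable {g : Prop}

@[simp]
theorem cls_par (P Q : Proc) : cls g (.par P Q) = cls g P * cls g Q := rfl

@[simp]
theorem cls_nil : cls g .nil = 1 := rfl

@[simp]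
theorem cls_res (P : Proc) : cls g (.res P) = (cls g P).res := rfl

@[simp]
theorem cls_repl (P : Proc) : cls g (.repl P) = (cls g P).repl := rfl

@[simp]
theorem res_one : (1 : GClass g).res = 1 := GCong.res_nil.eq

theorem repl_eq (c : GClass g) : c.repl = c * c.repl := by
  obtain ⟨P⟩ := c; exact (GCong.repl_unfold P).eq

/-- Scope extrusion for classes. A factor leaves the scope exactly when it is a shifted process,
that is, when it does not mention the restricted name. -/
theorem res_rename_mul (P : Proc) (c : GClass g) :
    (cls g (P.rename (· + 1)) * c).res = cls g P * c.res := by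
  obtain ⟨Q⟩ := c; exact (GCong.par_res P Q).symm.eq

theorem res_mul_rename (P : Proc) (c : GClass g) :
    (c * cls g (P.rename (· + 1))).res = c.res * cls g P := by
  rw [mul_comm, res_rename_mul, mul_comm]

theorem res_rename (P : Proc) : (cls g (P.rename (· + 1))).res = cls g P := by
  simpa using res_rename_mul (g := g) P 1

theorem res_res_swap (P : Proc) :
    (cls g (P.rename (Equiv.swap 0 1))).res.res = (cls g P).res.res :=
  (GCong.res_res P).symm.eq

/-! ### Exposed threads -/

/-- A process `P` exposes a thread (a case or the success process) to an environment `e`.  The base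
relation `K` tells what the thread becomes in presence of `e`, and the last argument is what `P`
becomes then.  On the way from `P` to the thread, `e` is renamed below every restriction. -/
inductive Expose {E : Type} (ren : (ℕ → ℕ) → E → E) (K : E → Proc → Proc → Prop) :
    E → Proc → Proc → Prop
  | ok {e : E} {R : Proc} : K e .ok R → Expose ren K e .ok R
  | case {e : E} {p : Pat} {P R : Proc} : K e (.case p P) R → Expose ren K e (.case p P) R
  | parL {e : E} {P R : Proc} (Q : Proc) :
      Expose ren K e P R → Expose ren K e (.par P Q) (.par R Q)
  | parR {e : E} (P : Proc) {Q R : Proc} :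
      Expose ren K e Q R → Expose ren K e (.par P Q) (.par P R)
  | repl {e : E} {P R : Proc} :
      Expose ren K e P R → Expose ren K e (.repl P) (.par R (.repl P))
  | res {e : E} {P R : Proc} :
      Expose ren K (ren (· + 1) e) P R → Expose ren K e (.res P) (.res R)

/-- Base relations that respect structural congruence and injective renaming and to which blocked
cases are invisible. -/
structure Natural (g : Prop) {E : Type} (ren : (ℕ → ℕ) → E → E) (K : E → Proc → Proc → Prop) :
    Prop where
  ren_id : ∀ e, ren id e = e
  ren_ren : ∀ f h e, ren h (ren f e) = ren (h ∘ f) e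
  gcong : ∀ {e p A B R}, GCong g A B → K e (.case p A) R →
    ∃ R', K e (.case p B) R' ∧ cls g R = cls g R'
  rename : ∀ {f e T R}, Function.Injective f → K e T R → K (ren f e) (T.rename f) (R.rename f)
  of_rename : ∀ {f e T R'}, Function.Injective f → K (ren f e) (T.rename f) R' →
    ∃ R, R' = R.rename f ∧ K e T R
  dead : ∀ {f i e p A R}, i ∉ Set.range f → ¬ K (ren f e) (.case (.comp (.prot i) p) A) R

namespace Natural

variable {E : Type} {ren : (ℕ → ℕ) → E → E} {K : E → Proc → Proc → Prop}

theorem ren_add_one (hK : Natural g ren K) (f : ℕ → ℕ) (e : E) :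
    ren (· + 1) (ren f e) = ren (liftRenaming 1 f) (ren (· + 1) e) := by
  rw [hK.ren_ren, hK.ren_ren, liftRenaming_comp_add]

theorem expose_rename (hK : Natural g ren K) {f : ℕ → ℕ} (hf : Function.Injective f) {e : E}
    {P R : Proc} (h : Expose ren K e P R) :
    Expose ren K (ren f e) (P.rename f) (R.rename f) := by
  induction h generalizing f with
  | ok h => exact .ok (hK.rename hf h)
  | case h =>
    have := hK.rename hf h
    rw [Proc.rename_case] at this ⊢
    exact .case this
  | parL Q _ ih => exact (ih hf).parL _
  | parR P _ ih => exact (ih hf).parR _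
  | repl _ ih => exact (ih hf).repl
  | res _ ih =>
    have := ih (liftRenaming_injective 1 hf)
    rw [← hK.ren_add_one] at this
    rw [Proc.rename_res, Proc.rename_res]
    exact this.res

/-- Needed for scope extrusion read from right to left: a thread exposed by the shifted component
under the restriction has to come from the unshifted component outside. -/
theorem expose_of_rename (hK : Natural g ren K) {f : ℕ → ℕ} (hf : Function.Injective f) {e : E}
    {P R' : Proc} (h : Expose ren K (ren f e) (P.rename f) R') :
    ∃ R, R' = R.rename f ∧ Expose ren K e P R := by
  induction P generalizing f e R' with
  | nil => cases h
  | ok =>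
    cases h with
    | ok h =>
      obtain ⟨R, rfl, h'⟩ := hK.of_rename (T := .ok) hf h
      exact ⟨R, rfl, .ok h'⟩
  | par P Q hP hQ =>
    cases h with
    | parL _ h =>
      obtain ⟨R, rfl, h'⟩ := hP hf h
      exact ⟨_, rfl, h'.parL _⟩
    | parR _ h =>
      obtain ⟨R, rfl, h'⟩ := hQ hf h
      exact ⟨_, rfl, h'.parR _⟩
  | repl P hP =>
    cases h with
    | repl h =>
      obtain ⟨R, rfl, h'⟩ := hP hf h
      exact ⟨_, rfl, h'.repl⟩
  | res P hP =>
    rw [Proc.rename_res] at h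
    cases h with
    | res h =>
      rw [hK.ren_add_one] at h
      obtain ⟨R, rfl, h'⟩ := hP (liftRenaming_injective 1 hf) h
      exact ⟨_, (Proc.rename_res _ _).symm, h'.res⟩
  | case p P hP =>
    rw [Proc.rename_case] at h
    cases h with
    | case h =>
      rw [← Proc.rename_case] at h
      obtain ⟨R, rfl, h'⟩ := hK.of_rename hf h
      exact ⟨R, rfl, .case h'⟩

/-- Both directions are proved together because `GCong` has a symmetry rule. The residuals can agree
only up to `GCong`, since the laws rearrange what surrounds the thread. -/
theorem expose_gcong_aux (hK : Natural g ren K) {P Q : Proc} (h : GCong g P Q) (e : E) :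
    (∀ R, Expose ren K e P R → ∃ R', Expose ren K e Q R' ∧ cls g R = cls g R') ∧
    (∀ R, Expose ren K e Q R → ∃ R', Expose ren K e P R' ∧ cls g R = cls g R') := by
  induction h generalizing e with
  | par_nil P =>
    refine ⟨fun R h => ?_, fun R h => ⟨_, h.parL _, by simp⟩⟩
    cases h with
    | parL _ h => exact ⟨_, h, by simp⟩
    | parR _ h => cases h
  | par_comm P Q =>
    constructor <;> intro R h <;> cases h with
    | parL _ h => exact ⟨_, h.parR _, by simp [mul_comm]⟩
    | parR _ h => exact ⟨_, h.parL _, by simp [mul_comm]⟩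
  | par_assoc P Q S =>
    constructor <;> intro R h
    · cases h with
      | parL _ h => exact ⟨_, (h.parL _).parL _, by simp [mul_assoc]⟩
      | parR _ h =>
        cases h with
        | parL _ h => exact ⟨_, (h.parR _).parL _, by simp [mul_assoc]⟩
        | parR _ h => exact ⟨_, h.parR _, by simp [mul_assoc]⟩
    · cases h with
      | parL _ h =>
        cases h with
        | parL _ h => exact ⟨_, h.parL _, by simp [mul_assoc]⟩
        | parR _ h => exact ⟨_, (h.parL _).parR _, by simp [mul_assoc]⟩
      | parR _ h => exact ⟨_, (h.parR _).parR _, by simp [mul_assoc]⟩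
  | res_nil =>
    refine ⟨fun R h => ?_, fun R h => by cases h⟩
    cases h with
    | res h => cases h
  | res_res P =>
    have key : ∀ {P R}, Expose ren K e (.res (.res P)) R → ∃ R',
        Expose ren K e (.res (.res (P.rename (Equiv.swap 0 1)))) R' ∧ cls g R = cls g R' := by
      intro P R h
      cases h with
      | res h =>
        cases h with
        | res h =>
          have h := hK.expose_rename (Equiv.swap 0 1).injective h
          rw [hK.ren_ren, hK.ren_ren] at h
          -- The environment has been shifted past both restrictions and does not notice their
          -- exchange.
          have hs : ((⇑(Equiv.swap (0 : ℕ) 1) ∘ (· + 1)) ∘ (· + 1)) = ((· + 1) ∘ (· + 1)) :=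
            funext swap_zero_one_add_two
          rw [hs, ← hK.ren_ren] at h
          exact ⟨_, h.res.res, (res_res_swap _).symm⟩
    refine ⟨fun R => key, fun R h => ?_⟩
    obtain ⟨R', h, hR⟩ := key h
    rw [Proc.rename_swap_rename_swap] at h
    exact ⟨R', h, hR⟩
  | repl_unfold P =>
    constructor <;> intro R h
    · cases h with
      | repl h => exact ⟨_, h.parL _, rfl⟩
    · cases h with
      | parL _ h => exact ⟨_, h.repl, rfl⟩
      | parR _ h =>
        cases h with
        | repl h =>
          -- A thread from the replication in `P | !P` leaves an additional copy of `P` beside `!P`,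
          -- which `!P` absorbs.
          refine ⟨_, h.repl, ?_⟩
          simp only [cls_par, cls_repl]
          rw [mul_left_comm, ← repl_eq]
  | par_res P Q =>
    constructor <;> intro R h
    · cases h with
      | parL _ h =>
        exact ⟨_, ((hK.expose_rename (add_left_injective 1) h).parL _).res,
          by simp [res_rename_mul]⟩
      | parR _ h =>
        cases h with
        | res h => exact ⟨_, (h.parR _).res, by simp [res_rename_mul]⟩
    · cases h with
      | res h =>
        cases h with
        | parL _ h =>
          obtain ⟨R, rfl, h'⟩ := hK.expose_of_rename (add_left_injective 1) h
          exact ⟨_, h'.parL _, by simp [res_rename_mul]⟩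
        | parR _ h => exact ⟨_, h.res.parR _, by simp [res_rename_mul]⟩
  | dead hg p P =>
    refine ⟨fun R h => ?_, fun R h => by cases h⟩
    cases h with
    | res h =>
      cases h with
      -- The environment was shifted on entering the restriction, so the protected index `0` is
      -- outside the range of its names.
      | case h => exact (hK.dead (by simp) h).elim
  | refl P => exact ⟨fun R h => ⟨R, h, rfl⟩, fun R h => ⟨R, h, rfl⟩⟩
  | symm _ ih => exact (ih e).symm
  | trans _ _ ih₁ ih₂ =>
    constructor <;> intro R h
    · obtain ⟨R₁, h, hR⟩ := (ih₁ e).1 R h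
      obtain ⟨R₂, h, hR'⟩ := (ih₂ e).1 R₁ h
      exact ⟨R₂, h, hR.trans hR'⟩
    · obtain ⟨R₁, h, hR⟩ := (ih₂ e).2 R h
      obtain ⟨R₂, h, hR'⟩ := (ih₁ e).2 R₁ h
      exact ⟨R₂, h, hR.trans hR'⟩
  | par h₁ h₂ ih₁ ih₂ =>
    constructor <;> intro R h <;> cases h with
    | parL _ h =>
      first
      | obtain ⟨R', h, hR⟩ := (ih₁ e).1 _ h
        exact ⟨_, h.parL _, by simp [hR, h₂.eq]⟩
      | obtain ⟨R', h, hR⟩ := (ih₁ e).2 _ h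
        exact ⟨_, h.parL _, by simp [hR, h₂.eq]⟩
    | parR _ h =>
      first
      | obtain ⟨R', h, hR⟩ := (ih₂ e).1 _ h
        exact ⟨_, h.parR _, by simp [hR, h₁.eq]⟩
      | obtain ⟨R', h, hR⟩ := (ih₂ e).2 _ h
        exact ⟨_, h.parR _, by simp [hR, h₁.eq]⟩
  | repl h₁ ih =>
    constructor <;> intro R h <;> cases h with
    | repl h =>
      first
      | obtain ⟨R', h, hR⟩ := (ih e).1 _ h
        exact ⟨_, h.repl, by simp [hR, h₁.eq]⟩
      | obtain ⟨R', h, hR⟩ := (ih e).2 _ h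
        exact ⟨_, h.repl, by simp [hR, h₁.eq]⟩
  | res h₁ ih =>
    constructor <;> intro R h <;> cases h with
    | res h =>
      first
      | obtain ⟨R', h, hR⟩ := (ih _).1 _ h
        exact ⟨_, h.res, by simp [hR]⟩
      | obtain ⟨R', h, hR⟩ := (ih _).2 _ h
        exact ⟨_, h.res, by simp [hR]⟩
  | case p h₁ ih =>
    constructor <;> intro R h <;> cases h with
    | case h =>
      first
      | obtain ⟨R', h, hR⟩ := hK.gcong h₁ h
        exact ⟨_, .case h, hR⟩
      | obtain ⟨R', h, hR⟩ := hK.gcong h₁.symm h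
        exact ⟨_, .case h, hR⟩

theorem expose_gcong (hK : Natural g ren K) {P Q : Proc} (h : GCong g P Q) {e : E} {R : Proc}
    (h' : Expose ren K e P R) : ∃ R', Expose ren K e Q R' ∧ cls g R = cls g R' :=
  (hK.expose_gcong_aux h e).1 R h'

end Natural

/-! ### Interaction -/

/-- The cases `T` and `U` unify and become `R`. -/
def React (U T R : Proc) : Prop :=
  ∃ p A q B σ ρ, U = .case q B ∧ T = .case p A ∧ Unify p q σ ρ ∧
    R = .par (A.subst (inst σ)) (B.subst (inst ρ))

theorem React.symm {U T R : Proc} (h : React U T R) :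
    ∃ R', React T U R' ∧ cls g R = cls g R' := by
  obtain ⟨p, A, q, B, σ, ρ, rfl, rfl, h, rfl⟩ := h
  exact ⟨_, ⟨q, B, p, A, ρ, σ, rfl, rfl, h.symm, rfl⟩, by simp [mul_comm]⟩

theorem natural_react (g : Prop) : Natural g Proc.rename React where
  ren_id := Proc.rename_id
  ren_ren f h P := Proc.rename_rename f h P
  gcong := by
    rintro e p A B R h ⟨p, A, q, D, σ, ρ, rfl, hT, hu, rfl⟩
    cases hT
    exact ⟨_, ⟨p, B, q, D, σ, ρ, rfl, rfl, hu, rfl⟩, by simp [(h.subst (inst σ)).eq]⟩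
  rename := by
    rintro f e T R hf ⟨p, A, q, B, σ, ρ, rfl, rfl, hu, rfl⟩
    refine ⟨_, _, _, _, _, _, Proc.rename_case _ _ _, Proc.rename_case _ _ _, hu.rename f, ?_⟩
    rw [Proc.rename_par, Proc.rename_subst_inst, Proc.rename_subst_inst, hu.length_left,
      hu.length_right]
  of_rename := by
    rintro f e T R' hf ⟨p', A', q', B', σ', ρ', he, hT, hu, rfl⟩
    cases e <;> simp [Proc.rename, Proc.subst] at he
    cases T <;> simp [Proc.rename, Proc.subst] at hT
    obtain ⟨rfl, rfl⟩ := he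
    obtain ⟨rfl, rfl⟩ := hT
    obtain ⟨σ, ρ, hu', rfl, rfl⟩ := hu.of_rename hf
    refine ⟨_, ?_, _, _, _, _, σ, ρ, rfl, rfl, hu', rfl⟩
    rw [Proc.rename_par, Proc.rename_subst_inst, Proc.rename_subst_inst, hu'.length_left,
      hu'.length_right, liftSubst_name, liftSubst_name]
    rfl
  dead := by
    rintro f i e p A R hi ⟨p', A', q', B', σ', ρ', he, hT, hu, rfl⟩
    cases hT
    cases e <;> simp [Proc.rename, Proc.subst] at he
    obtain ⟨rfl, rfl⟩ := he
    exact hu.symm.not_comp_prot hi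

/-- The process `P` reacts with a thread `T`. -/
abbrev ReactWith (P T R : Proc) : Prop := Expose Proc.rename React T P R

/-- The processes `P` and `Q` interact. -/
abbrev Interact (P Q R : Proc) : Prop := Expose Proc.rename ReactWith P Q R

theorem ReactWith.gcong_thread {p : Pat} {A B P R : Proc} (hA : GCong g A B)
    (h : ReactWith P (.case p A) R) :
    ∃ R', ReactWith P (.case p B) R' ∧ cls g R = cls g R' := by
  generalize hT : Proc.case p A = T at h
  induction h generalizing p A B with
  | ok h =>
    obtain ⟨_, _, _, _, _, _, _, h, _⟩ := h
    cases h
  | case h =>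
    obtain ⟨p, A', q, D, σ, ρ, rfl, hT', hu, rfl⟩ := h
    cases hT
    cases hT'
    exact ⟨_, .case ⟨_, _, _, B, _, _, rfl, rfl, hu, rfl⟩, by simp [(hA.subst (inst ρ)).eq]⟩
  | parL Q _ ih =>
    obtain ⟨R', h, hR⟩ := ih hA hT
    exact ⟨_, h.parL _, by simp [hR]⟩
  | parR P _ ih =>
    obtain ⟨R', h, hR⟩ := ih hA hT
    exact ⟨_, h.parR _, by simp [hR]⟩
  | repl _ ih =>
    obtain ⟨R', h, hR⟩ := ih hA hT
    exact ⟨_, h.repl, by simp [hR]⟩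
  | res _ ih =>
    subst hT
    obtain ⟨R', h, hR⟩ := ih (hA.rename _) (Proc.rename_case _ _ _).symm
    rw [← Proc.rename_case] at h
    exact ⟨_, h.res, by simp [hR]⟩

/-- The private name stays unknown to `P` at any depth: a restriction inside `P` shifts the index
and lifts the renaming alike. -/
theorem ReactWith.not_dead {f : ℕ → ℕ} {i : ℕ} (hi : i ∉ Set.range f) {p : Pat} {A P R : Proc} :
    ¬ ReactWith (P.rename f) (.case (.comp (.prot i) p) A) R := by
  induction P generalizing f i p A R with
  | nil => intro h; cases h
  | ok =>
    intro h
    cases h with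
    | ok h =>
      obtain ⟨_, _, _, _, _, _, _, h, _⟩ := h
      cases h
  | par P Q hP hQ =>
    intro h
    cases h with
    | parL _ h => exact hP hi h
    | parR _ h => exact hQ hi h
  | repl P hP =>
    intro h
    cases h with
    | repl h => exact hP hi h
  | res P hP =>
    intro h
    rw [Proc.rename_res] at h
    cases h with
    | res h =>
      rw [Proc.rename_case] at h
      exact hP (add_notMem_range_liftRenaming 1 hi) h
  | case q P hP =>
    intro h
    rw [Proc.rename_case] at h
    cases h with
    | case h =>
      obtain ⟨_, _, _, _, _, _, h₁, h₂, hu, _⟩ := h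
      cases h₁
      cases h₂
      exact hu.not_comp_prot hi

theorem natural_reactWith (g : Prop) : Natural g Proc.rename ReactWith where
  ren_id := Proc.rename_id
  ren_ren f h P := Proc.rename_rename f h P
  gcong h h' := h'.gcong_thread h
  rename hf h := (natural_react g).expose_rename hf h
  of_rename hf h := (natural_react g).expose_of_rename hf h
  dead hi h := ReactWith.not_dead hi h

/-- The base of the symmetry of `Interact`: the case exposed by `P` becomes the exposed thread, and
`U`, a bare case, becomes the process that reacts with it. -/
theorem ReactWith.interact {U P R : Proc} (h : ReactWith P U R) :
    ∃ R', Interact U P R' ∧ cls g R = cls g R' := by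
  induction h with
  | ok h =>
    obtain ⟨_, _, _, _, _, _, _, h, _⟩ := h
    cases h
  | case h =>
    obtain ⟨R', h', hR⟩ := h.symm (g := g)
    obtain ⟨_, _, _, _, _, _, rfl, _⟩ := h
    exact ⟨R', .case (.case h'), hR⟩
  | parL Q _ ih =>
    obtain ⟨R', h, hR⟩ := ih
    exact ⟨_, h.parL _, by simp [hR]⟩
  | parR P _ ih =>
    obtain ⟨R', h, hR⟩ := ih
    exact ⟨_, h.parR _, by simp [hR]⟩
  | repl _ ih =>
    obtain ⟨R', h, hR⟩ := ih
    exact ⟨_, h.repl, by simp [hR]⟩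
  | res _ ih =>
    obtain ⟨R', h, hR⟩ := ih
    exact ⟨_, h.res, by simp [hR]⟩

namespace Interact

/-- Common core of the next three lemmas. Read `Φ P P' S` as: `P'` can do what `P` does and keeps
`S` aside. Stability under renaming is required because the left process is shifted below the
restrictions of `Q`. -/
theorem frame {Φ : Proc → Proc → Proc → Prop}
    (hren : ∀ {P P' S} (f : ℕ → ℕ), Φ P P' S → Φ (P.rename f) (P'.rename f) (S.rename f))
    (hΦ : ∀ {P P' S T R}, Φ P P' S → ReactWith P T R →
      ∃ R', ReactWith P' T R' ∧ cls g R' = cls g R * cls g S)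
    {P P' Q R S : Proc} (hP : Φ P P' S) (h : Interact P Q R) :
    ∃ R', Interact P' Q R' ∧ cls g R' = cls g R * cls g S := by
  induction h generalizing P' S with
  | ok h =>
    obtain ⟨R', h, hR⟩ := hΦ hP h
    exact ⟨_, .ok h, hR⟩
  | case h =>
    obtain ⟨R', h, hR⟩ := hΦ hP h
    exact ⟨_, .case h, hR⟩
  | parL Q _ ih =>
    obtain ⟨R', h, hR⟩ := ih hP
    exact ⟨_, h.parL _, by simp only [cls_par, hR]; ac_rfl⟩
  | parR P _ ih =>
    obtain ⟨R', h, hR⟩ := ih hP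
    exact ⟨_, h.parR _, by simp only [cls_par, hR]; ac_rfl⟩
  | repl _ ih =>
    obtain ⟨R', h, hR⟩ := ih hP
    exact ⟨_, h.repl, by simp only [cls_par, hR]; ac_rfl⟩
  | res _ ih =>
    obtain ⟨R', h, hR⟩ := ih (hren (· + 1) hP)
    exact ⟨_, h.res, by simp only [cls_res, hR, res_mul_rename]⟩

theorem par_left {P Q R : Proc} (S : Proc) (h : Interact P Q R) :
    ∃ R', Interact (.par P S) Q R' ∧ cls g R' = cls g R * cls g S :=
  frame (Φ := fun P P' S => P' = .par P S) (by rintro _ _ _ f rfl; rfl)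
    (by rintro _ _ _ _ _ rfl h; exact ⟨_, h.parL _, rfl⟩) rfl h

theorem par_right {P Q R : Proc} (S : Proc) (h : Interact P Q R) :
    ∃ R', Interact (.par S P) Q R' ∧ cls g R' = cls g R * cls g S :=
  frame (Φ := fun P P' S => P' = .par S P) (by rintro _ _ _ f rfl; rfl)
    (by rintro _ _ _ _ _ rfl h; exact ⟨_, h.parR _, by simp [mul_comm]⟩) rfl h

theorem repl_left {P Q R : Proc} (h : Interact P Q R) :
    ∃ R', Interact (.repl P) Q R' ∧ cls g R' = cls g R * cls g (.repl P) :=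
  frame (Φ := fun P P' S => P' = .repl P ∧ S = .repl P)
    (by rintro _ _ _ f ⟨rfl, rfl⟩; exact ⟨rfl, rfl⟩)
    (by rintro _ _ _ _ _ ⟨rfl, rfl⟩ h; exact ⟨_, h.repl, rfl⟩) ⟨rfl, rfl⟩ h

/-- Moves a restriction from around the whole interaction to its left component. The right component
does not mention the restricted name, so its remaining parts extrude. -/
theorem res_left {P Q R : Proc} (h : Interact P (Q.rename (· + 1)) R) :
    ∃ R', Interact (.res P) Q R' ∧ cls g R' = (cls g R).res := by
  induction Q generalizing P R with
  | nil => cases h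
  | ok =>
    cases h with
    | ok h => exact ⟨_, .ok h.res, rfl⟩
  | par Q S hQ hS =>
    cases h with
    | parL _ h =>
      obtain ⟨R', h, hR⟩ := hQ h
      exact ⟨_, h.parL _, by rw [cls_par, hR]; exact (res_mul_rename _ _).symm⟩
    | parR _ h =>
      obtain ⟨R', h, hR⟩ := hS h
      exact ⟨_, h.parR _, by rw [cls_par, hR]; exact (res_rename_mul _ _).symm⟩
  | repl Q hQ =>
    cases h with
    | repl h =>
      obtain ⟨R', h, hR⟩ := hQ h
      exact ⟨_, h.repl, by rw [cls_par, hR]; exact (res_mul_rename _ (cls g _)).symm⟩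
  | res Q hQ =>
    rw [Proc.rename_res] at h
    cases h with
    | @res _ _ R h =>
      -- A restriction inside the right component lies below the one that is being moved. Exchanging
      -- the indices `0` and `1` brings the derivation to the form the induction hypothesis expects.
      have hs : (⇑(Equiv.swap (0 : ℕ) 1) ∘ (· + 1)) = liftRenaming 1 (· + 1) := by
        funext i
        rcases i with _ | i
        · simp [liftRenaming]
        · simp [liftRenaming, swap_zero_one_add_two]
      have hs' : ⇑(Equiv.swap (0 : ℕ) 1) ∘ liftRenaming 1 (· + 1) = (· + 1) := by
        rw [← hs, ← Function.comp_assoc, swap_zero_one_involutive.comp_self, Function.id_comp]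
      have h := (natural_reactWith g).expose_rename (Equiv.swap 0 1).injective h
      rw [Proc.rename_rename, Proc.rename_rename, hs, hs'] at h
      obtain ⟨R', h, hR⟩ := hQ h
      refine ⟨_, .res ((Proc.rename_res _ _).symm ▸ h), ?_⟩
      rw [cls_res, hR, res_res_swap, cls_res]
  | case p A hA =>
    rw [Proc.rename_case] at h
    cases h with
    | case h =>
      rw [← Proc.rename_case] at h
      exact ⟨_, .case h.res, rfl⟩

/-- The definition treats the two sides asymmetrically. Walking down `Q` to its thread, each
constructor passed is put back around `Q` as a left component by `par_left`, `par_right`,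
`repl_left` or `res_left`. -/
theorem symm {P Q R : Proc} (h : Interact P Q R) :
    ∃ R', Interact Q P R' ∧ cls g R' = cls g R := by
  induction h with
  | ok h =>
    obtain ⟨R', h, hR⟩ := ReactWith.interact (g := g) h
    exact ⟨_, h, hR.symm⟩
  | case h =>
    obtain ⟨R', h, hR⟩ := ReactWith.interact (g := g) h
    exact ⟨_, h, hR.symm⟩
  | parL Q _ ih =>
    obtain ⟨R', h, hR⟩ := ih
    obtain ⟨R'', h, hR'⟩ := h.par_left (g := g) Q
    exact ⟨_, h, by simp [hR, hR']⟩
  | parR P _ ih =>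
    obtain ⟨R', h, hR⟩ := ih
    obtain ⟨R'', h, hR'⟩ := h.par_right (g := g) P
    exact ⟨_, h, by simp [hR, hR', mul_comm]⟩
  | repl _ ih =>
    obtain ⟨R', h, hR⟩ := ih
    obtain ⟨R'', h, hR'⟩ := h.repl_left (g := g)
    exact ⟨_, h, by simp [hR, hR']⟩
  | res _ ih =>
    obtain ⟨R', h, hR⟩ := ih
    obtain ⟨R'', h, hR'⟩ := h.res_left (g := g)
    exact ⟨_, h, by simp [hR, hR']⟩

/-- Naturality handles the right component; symmetry reduces the left one to it. -/
theorem gcong {P P' Q Q' R : Proc} (hP : GCong g P P') (hQ : GCong g Q Q')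
    (h : Interact P Q R) : ∃ R', Interact P' Q' R' ∧ cls g R' = cls g R := by
  obtain ⟨R₁, h, hR₁⟩ := (natural_reactWith g).expose_gcong hQ h
  obtain ⟨R₂, h, hR₂⟩ := Interact.symm (g := g) h
  obtain ⟨R₃, h, hR₃⟩ := (natural_reactWith g).expose_gcong hP h
  obtain ⟨R₄, h, hR₄⟩ := Interact.symm (g := g) h
  exact ⟨R₄, h, by rw [hR₄, ← hR₃, hR₂, hR₁]⟩

theorem red_of_reactWith {P T R : Proc} (h : ReactWith P T R) : Red (.par P T) R := by
  -- Closure of reduction under structural congruence, with congruences written as equations between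
  -- classes.
  have key : ∀ {P Q R S : Proc}, cls False P = cls False Q → Red Q R → cls False R = cls False S →
      Red P S := fun h h' h'' => .struct (cls_eq.1 h).cong h' (cls_eq.1 h'').cong
  induction h with
  | ok h =>
    obtain ⟨_, _, _, _, _, _, _, h, _⟩ := h
    cases h
  | case h =>
    obtain ⟨_, _, _, _, _, _, rfl, h, hu, rfl⟩ := h
    cases h
    exact .unify _ _ hu
  | parL Q _ ih => exact key (by simp only [cls_par]; ac_rfl) (ih.par Q) rfl
  | parR P _ ih => exact key (by simp only [cls_par]; ac_rfl) (ih.par P) (by simp [mul_comm])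
  | @repl _ P _ _ ih =>
    refine key ?_ (ih.par (.repl P)) rfl
    rw [cls_par, cls_repl, repl_eq, cls_par, cls_par, cls_repl]
    ac_rfl
  | res _ ih => exact key (by simp [res_mul_rename]) ih.res rfl

theorem red {P Q R : Proc} (h : Interact P Q R) : Red (.par P Q) R := by
  have key : ∀ {P Q R S : Proc}, cls False P = cls False Q → Red Q R → cls False R = cls False S →
      Red P S := fun h h' h'' => .struct (cls_eq.1 h).cong h' (cls_eq.1 h'').cong
  induction h with
  | ok h => exact red_of_reactWith h
  | case h => exact red_of_reactWith h
  | parL Q _ ih => exact key (by simp only [cls_par]; ac_rfl) (ih.par Q) rfl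
  | parR P _ ih => exact key (by simp only [cls_par]; ac_rfl) (ih.par P) (by simp [mul_comm])
  | @repl _ P _ _ ih =>
    refine key ?_ (ih.par (.repl P)) rfl
    rw [cls_par, cls_repl, repl_eq, cls_par, cls_par, cls_repl]
    ac_rfl
  | res _ ih => exact key (by simp [res_rename_mul]) ih.res rfl

end Interact

/-! ### Reduction without structural congruence -/

/-- Reduction, defined by induction on the process. -/
inductive Step : Proc → Proc → Prop
  | interact {P Q R : Proc} : Interact P Q R → Step (.par P Q) R
  | parL {P P' : Proc} (Q : Proc) : Step P P' → Step (.par P Q) (.par P' Q)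
  | parR (P : Proc) {Q Q' : Proc} : Step Q Q' → Step (.par P Q) (.par P Q')
  | repl {P P' : Proc} : Step P P' → Step (.repl P) (.par P' (.repl P))
  | repl_interact {P R : Proc} : Interact P P R → Step (.repl P) (.par R (.repl P))
  | res {P P' : Proc} : Step P P' → Step (.res P) (.res P')

namespace Step

theorem rename {f : ℕ → ℕ} (hf : Function.Injective f) {P R : Proc} (h : Step P R) :
    Step (P.rename f) (R.rename f) := by
  induction h generalizing f with
  | interact h => exact .interact ((natural_reactWith False).expose_rename hf h)
  | parL Q _ ih => exact (ih hf).parL _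
  | parR P _ ih => exact (ih hf).parR _
  | repl _ ih => exact (ih hf).repl
  | repl_interact h => exact .repl_interact ((natural_reactWith False).expose_rename hf h)
  | res _ ih =>
    rw [Proc.rename_res, Proc.rename_res]
    exact (ih (liftRenaming_injective 1 hf)).res

theorem of_rename {f : ℕ → ℕ} (hf : Function.Injective f) {P R' : Proc}
    (h : Step (P.rename f) R') : ∃ R, R' = R.rename f ∧ Step P R := by
  induction P generalizing f R' with
  | nil => cases h
  | ok => cases h
  | par P Q hP hQ =>
    cases h with
    | interact h =>
      obtain ⟨R, rfl, h'⟩ := (natural_reactWith False).expose_of_rename hf h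
      exact ⟨_, rfl, .interact h'⟩
    | parL _ h =>
      obtain ⟨R, rfl, h'⟩ := hP hf h
      exact ⟨_, rfl, h'.parL _⟩
    | parR _ h =>
      obtain ⟨R, rfl, h'⟩ := hQ hf h
      exact ⟨_, rfl, h'.parR _⟩
  | repl P hP =>
    cases h with
    | repl h =>
      obtain ⟨R, rfl, h'⟩ := hP hf h
      exact ⟨_, rfl, h'.repl⟩
    | repl_interact h =>
      obtain ⟨R, rfl, h'⟩ := (natural_reactWith False).expose_of_rename hf h
      exact ⟨_, rfl, .repl_interact h'⟩
  | res P hP =>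
    rw [Proc.rename_res] at h
    cases h with
    | res h =>
      obtain ⟨R, rfl, h'⟩ := hP (liftRenaming_injective 1 hf) h
      exact ⟨_, (Proc.rename_res _ _).symm, h'.res⟩
  | case p P hP => cases h

theorem red {P R : Proc} (h : Step P R) : Red P R := by
  have key : ∀ {P Q R S : Proc}, cls False P = cls False Q → Red Q R → cls False R = cls False S →
      Red P S := fun h h' h'' => .struct (cls_eq.1 h).cong h' (cls_eq.1 h'').cong
  induction h with
  | interact h => exact h.red
  | parL Q _ ih => exact ih.par Q
  | parR P _ ih => exact key (by simp [mul_comm]) (ih.par P) (by simp [mul_comm])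
  | @repl P _ _ ih => exact key (repl_eq (cls _ P)) (ih.par (.repl P)) rfl
  | @repl_interact P _ h =>
    -- The replication is unfolded twice, to obtain the two copies of `P` that interact.
    refine key ?_ (h.red.par (.repl P)) rfl
    simp only [cls_par, cls_repl]
    rw [mul_assoc, ← repl_eq, ← repl_eq]
  | res _ ih => exact ih.res

/-- The central inversion argument: each law merely changes which `Step` rule produces the
reduction. Associativity is where the symmetry of `Interact` is needed, as the partner of a thread
may sit in another group after regrouping. -/
theorem gcong_aux {P Q : Proc} (h : GCong g P Q) :
    (∀ R, Step P R → ∃ R', Step Q R' ∧ cls g R = cls g R') ∧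
    (∀ R, Step Q R → ∃ R', Step P R' ∧ cls g R = cls g R') := by
  induction h with
  | par_nil P =>
    refine ⟨fun R h => ?_, fun R h => ⟨_, h.parL _, by simp⟩⟩
    cases h with
    | interact h => cases h
    | parL _ h => exact ⟨_, h, by simp⟩
    | parR _ h => cases h
  | par_comm P Q =>
    constructor <;> intro R h <;> cases h with
    | interact h =>
      obtain ⟨R', h, hR⟩ := h.symm (g := g)
      exact ⟨_, .interact h, hR.symm⟩
    | parL _ h => exact ⟨_, h.parR _, by simp [mul_comm]⟩
    | parR _ h => exact ⟨_, h.parL _, by simp [mul_comm]⟩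
  | par_assoc P Q S =>
    constructor <;> intro R h
    · cases h with
      | interact h =>
        cases h with
        | parL _ h => exact ⟨_, (Step.interact h).parL _, rfl⟩
        | parR _ h =>
          obtain ⟨R', h, hR⟩ := Interact.par_left (g := g) Q h
          exact ⟨_, .interact h, by simp [hR, mul_comm]⟩
      | parL _ h => exact ⟨_, (h.parL _).parL _, by simp [mul_assoc]⟩
      | parR _ h =>
        cases h with
        | interact h =>
          obtain ⟨R', h, hR⟩ := h.par_right (g := g) P
          exact ⟨_, .interact h, by simp [hR, mul_comm]⟩
        | parL _ h => exact ⟨_, (h.parR _).parL _, by simp [mul_assoc]⟩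
        | parR _ h => exact ⟨_, h.parR _, by simp [mul_assoc]⟩
    · cases h with
      | interact h =>
        obtain ⟨R', h, hR⟩ := h.symm (g := g)
        rw [← hR]
        cases h with
        | parL _ h =>
          obtain ⟨R₁, h, hR₁⟩ := Interact.symm (g := g) h
          exact ⟨_, .interact (h.parR _), by simp [hR₁, mul_comm]⟩
        | parR _ h =>
          obtain ⟨R₁, h, hR₁⟩ := Interact.symm (g := g) h
          exact ⟨_, (Step.interact h).parR _, by simp [hR₁]⟩
      | parL _ h =>
        cases h with
        | interact h => exact ⟨_, .interact (h.parL _), rfl⟩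
        | parL _ h => exact ⟨_, h.parL _, by simp [mul_assoc]⟩
        | parR _ h => exact ⟨_, (h.parL _).parR _, by simp [mul_assoc]⟩
      | parR _ h => exact ⟨_, (h.parR _).parR _, by simp [mul_assoc]⟩
  | res_nil =>
    refine ⟨fun R h => ?_, fun R h => by cases h⟩
    cases h with
    | res h => cases h
  | res_res P =>
    have key : ∀ {P R}, Step (.res (.res P)) R → ∃ R',
        Step (.res (.res (P.rename (Equiv.swap 0 1)))) R' ∧ cls g R = cls g R' := by
      intro P R h
      cases h with
      | res h =>
        cases h with
        | res h =>
          exact ⟨_, (h.rename (Equiv.swap 0 1).injective).res.res, (res_res_swap _).symm⟩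
    refine ⟨fun R => key, fun R h => ?_⟩
    obtain ⟨R', h, hR⟩ := key h
    rw [Proc.rename_swap_rename_swap] at h
    exact ⟨R', h, hR⟩
  | repl_unfold P =>
    constructor <;> intro R h
    · cases h with
      | repl h => exact ⟨_, h.parL _, rfl⟩
      | repl_interact h => exact ⟨_, .interact h.repl, rfl⟩
    · cases h with
      | interact h =>
        cases h with
        | repl h => exact ⟨_, .repl_interact h, rfl⟩
      | parL _ h => exact ⟨_, h.repl, rfl⟩
      | parR _ h =>
        -- The unfolded copy of `P` that took no part in the step is absorbed by the replication.
        have aux : ∀ R : Proc, cls g (.par P (.par R (.repl P))) = cls g (.par R (.repl P)) := by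
          intro R
          simp only [cls_par, cls_repl]
          rw [mul_left_comm, ← repl_eq]
        cases h with
        | repl h => exact ⟨_, h.repl, aux _⟩
        | repl_interact h => exact ⟨_, .repl_interact h, aux _⟩
  | par_res P Q =>
    constructor <;> intro R h
    · cases h with
      | interact h =>
        cases h with
        | res h => exact ⟨_, (Step.interact h).res, rfl⟩
      | parL _ h =>
        exact ⟨_, ((h.rename (add_left_injective 1)).parL _).res, by simp [res_rename_mul]⟩
      | parR _ h =>
        cases h with
        | res h => exact ⟨_, (h.parR _).res, by simp [res_rename_mul]⟩
    · cases h with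
      | res h =>
        cases h with
        | interact h => exact ⟨_, .interact h.res, rfl⟩
        | parL _ h =>
          obtain ⟨R, rfl, h'⟩ := h.of_rename (add_left_injective 1)
          exact ⟨_, h'.parL _, by simp [res_rename_mul]⟩
        | parR _ h => exact ⟨_, h.res.parR _, by simp [res_rename_mul]⟩
  | dead hg p P =>
    refine ⟨fun R h => ?_, fun R h => by cases h⟩
    cases h with
    | res h => cases h
  | refl P => exact ⟨fun R h => ⟨R, h, rfl⟩, fun R h => ⟨R, h, rfl⟩⟩
  | symm _ ih => exact ih.symm
  | trans _ _ ih₁ ih₂ =>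
    constructor <;> intro R h
    · obtain ⟨R₁, h, hR⟩ := ih₁.1 R h
      obtain ⟨R₂, h, hR'⟩ := ih₂.1 R₁ h
      exact ⟨R₂, h, hR.trans hR'⟩
    · obtain ⟨R₁, h, hR⟩ := ih₂.2 R h
      obtain ⟨R₂, h, hR'⟩ := ih₁.2 R₁ h
      exact ⟨R₂, h, hR.trans hR'⟩
  | par h₁ h₂ ih₁ ih₂ =>
    constructor <;> intro R h
    · cases h with
      | interact h =>
        obtain ⟨R', h, hR⟩ := h.gcong h₁ h₂
        exact ⟨_, .interact h, hR.symm⟩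
      | parL _ h =>
        obtain ⟨R', h, hR⟩ := ih₁.1 _ h
        exact ⟨_, h.parL _, by simp [hR, h₂.eq]⟩
      | parR _ h =>
        obtain ⟨R', h, hR⟩ := ih₂.1 _ h
        exact ⟨_, h.parR _, by simp [hR, h₁.eq]⟩
    · cases h with
      | interact h =>
        obtain ⟨R', h, hR⟩ := h.gcong h₁.symm h₂.symm
        exact ⟨_, .interact h, hR.symm⟩
      | parL _ h =>
        obtain ⟨R', h, hR⟩ := ih₁.2 _ h
        exact ⟨_, h.parL _, by simp [hR, h₂.eq]⟩
      | parR _ h =>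
        obtain ⟨R', h, hR⟩ := ih₂.2 _ h
        exact ⟨_, h.parR _, by simp [hR, h₁.eq]⟩
  | repl h₁ ih =>
    constructor <;> intro R h
    · cases h with
      | repl h =>
        obtain ⟨R', h, hR⟩ := ih.1 _ h
        exact ⟨_, h.repl, by simp [hR, h₁.eq]⟩
      | repl_interact h =>
        obtain ⟨R', h, hR⟩ := h.gcong h₁ h₁
        exact ⟨_, .repl_interact h, by simp [hR, h₁.eq]⟩
    · cases h with
      | repl h =>
        obtain ⟨R', h, hR⟩ := ih.2 _ h
        exact ⟨_, h.repl, by simp [hR, h₁.eq]⟩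
      | repl_interact h =>
        obtain ⟨R', h, hR⟩ := h.gcong h₁.symm h₁.symm
        exact ⟨_, .repl_interact h, by simp [hR, h₁.eq]⟩
  | res h₁ ih =>
    constructor <;> intro R h
    · cases h with
      | res h =>
        obtain ⟨R', h, hR⟩ := ih.1 _ h
        exact ⟨_, h.res, by simp [hR]⟩
    · cases h with
      | res h =>
        obtain ⟨R', h, hR⟩ := ih.2 _ h
        exact ⟨_, h.res, by simp [hR]⟩
  | case p h₁ ih => constructor <;> intro R h <;> cases h

end Step

theorem GCong.step {P Q R : Proc} (h : GCong g P Q) (h' : Step P R) :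
    ∃ R', Step Q R' ∧ cls g R = cls g R' :=
  (Step.gcong_aux h).1 R h'

/-- Uses of structural congruence inside a derivation are pushed to its end, so reductions can be
inverted along the syntax. -/
theorem Red.step (g : Prop) {P R : Proc} (h : Red P R) :
    ∃ R', Step P R' ∧ cls g R = cls g R' := by
  induction h with
  | unify P Q hu => exact ⟨_, .interact (.case (.case ⟨_, _, _, _, _, _, rfl, rfl, hu, rfl⟩)), rfl⟩
  | par Q _ ih =>
    obtain ⟨R', h, hR⟩ := ih
    exact ⟨_, h.parL _, by simp [hR]⟩
  | res _ ih =>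
    obtain ⟨R', h, hR⟩ := ih
    exact ⟨_, h.res, by simp [hR]⟩
  | struct h₁ _ h₂ ih =>
    obtain ⟨R', h, hR⟩ := ih
    obtain ⟨R'', h, hR'⟩ := (h₁.gcong g).symm.step h
    exact ⟨_, h, by rw [← (h₂.gcong g).eq, hR, hR']⟩

/-- For `g = True` this says that erasing blocked cases neither adds nor removes reductions. -/
theorem GCong.red {P Q P' : Proc} (h : GCong g P Q) (h' : Red P P') :
    ∃ Q', Red Q Q' ∧ GCong g P' Q' := by
  obtain ⟨R, h₁, hR⟩ := h'.step g
  obtain ⟨R', h₂, hR'⟩ := h.step h₁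
  exact ⟨R', h₂.red, cls_eq.1 (hR.trans hR')⟩

/-! ### Barbs and success -/

/-- The base relation for barbs: the environment consists of the public names and of the public
names that have to occur in the pattern. -/
def ShowsBarb (e : Set ℕ × Set ℕ) (T R : Proc) : Prop :=
  R = .nil ∧ ∃ p A, T = .case p A ∧ p.pn ⊆ e.1 ∧ p.fn ∩ e.1 = e.2

theorem natural_showsBarb (g : Prop) :
    Natural g (fun f => Prod.map (Set.image f) (Set.image f)) ShowsBarb where
  ren_id e := by simp [Prod.map]
  ren_ren f h e := by simp [Prod.map, Set.image_image]
  gcong := by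
    rintro e p A B R h ⟨rfl, p, A, hT, h₁, h₂⟩
    cases hT
    exact ⟨_, ⟨rfl, _, _, rfl, h₁, h₂⟩, rfl⟩
  rename := by
    rintro f e T R hf ⟨rfl, p, A, rfl, h₁, h₂⟩
    refine ⟨rfl, _, _, Proc.rename_case _ _ _, ?_, ?_⟩
    · rw [Pat.pn_rename]
      exact Set.image_mono h₁
    · rw [Pat.fn_rename, Prod.map_fst, ← Set.image_inter hf, h₂, Prod.map_snd]
  of_rename := by
    rintro f e T R hf ⟨rfl, p, A, hT, h₁, h₂⟩
    cases T <;> simp [Proc.rename, Proc.subst] at hT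
    obtain ⟨rfl, rfl⟩ := hT
    refine ⟨.nil, rfl, rfl, _, _, rfl, ?_, ?_⟩
    · rw [Pat.pn_rename] at h₁
      exact (Set.image_subset_image_iff hf).1 h₁
    · rw [Pat.fn_rename, Prod.map_fst, ← Set.image_inter hf, Prod.map_snd] at h₂
      exact hf.image_injective h₂
  dead := by
    rintro f i e p A R hi ⟨rfl, p, A, hT, h₁, h₂⟩
    cases hT
    obtain ⟨j, _, hj⟩ := h₁ (Or.inl rfl : i ∈ _)
    exact hi ⟨j, hj⟩

/-- The process `P` exposes a case with the barb `e.2`, where `e.1` are the public names. -/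
abbrev ExposesBarb (e : Set ℕ × Set ℕ) (P R : Proc) : Prop :=
  Expose (fun f => Prod.map (Set.image f) (Set.image f)) ShowsBarb e P R

theorem cls_iterate_res (k : ℕ) (P : Proc) :
    cls g (Proc.res^[k] P) = GClass.res^[k] (cls g P) :=
  Function.Semiconj.iterate_right (f := cls g) (ga := Proc.res) (gb := GClass.res)
    (fun _ => rfl) k P

theorem iterate_res_mul (k : ℕ) (P : Proc) (c : GClass g) :
    GClass.res^[k] (c * cls g (P.rename (· + k))) = GClass.res^[k] c * cls g P := by
  induction k generalizing c P with
  | zero => rw [show P.rename (· + 0) = P from Proc.rename_id P]; rfl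
  | succ k ih =>
    rw [Function.iterate_succ_apply, Function.iterate_succ_apply]
    rw [show P.rename (· + (k + 1)) = (P.rename (· + k)).rename (· + 1) by
      rw [Proc.rename_rename]; rfl, res_mul_rename, ih]

/-- Restrictions on the way to the exposed case are extruded to the front, and everything else is
collected in `B`. The public names become the shifted ones. -/
theorem ExposesBarb.cong {e : Set ℕ × Set ℕ} {P R : Proc} (h : ExposesBarb e P R) :
    ∃ k p A B, cls g P = GClass.res^[k] (cls g (.case p A) * cls g B) ∧
      p.pn ⊆ (· + k) '' e.1 ∧ p.fn ∩ (· + k) '' e.1 = (· + k) '' e.2 := by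
  induction h with
  | ok h =>
    obtain ⟨_, _, _, h, _⟩ := h
    cases h
  | @case e q A R h =>
    obtain ⟨_, _, _, hT, h₁, h₂⟩ := h
    cases hT
    exact ⟨0, q, A, .nil, by simp, by simpa, by simpa⟩
  | parL Q _ ih =>
    obtain ⟨k, p, A, B, hP, h⟩ := ih
    refine ⟨k, p, A, .par B (Q.rename (· + k)), ?_, h⟩
    rw [cls_par, hP, cls_par, ← mul_assoc, iterate_res_mul]
  | parR Q _ ih =>
    obtain ⟨k, p, A, B, hP, h⟩ := ih
    refine ⟨k, p, A, .par B (Q.rename (· + k)), ?_, h⟩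
    rw [cls_par, hP, cls_par, ← mul_assoc, iterate_res_mul, mul_comm]
  | @repl e P _ _ ih =>
    obtain ⟨k, p, A, B, hP, h⟩ := ih
    refine ⟨k, p, A, .par B ((Proc.repl P).rename (· + k)), ?_, h⟩
    rw [cls_repl, repl_eq, hP, cls_par, ← mul_assoc, iterate_res_mul, cls_repl, hP]
  | res _ ih =>
    obtain ⟨k, p, A, B, hP, h₁, h₂⟩ := ih
    refine ⟨k + 1, p, A, B, ?_, ?_, ?_⟩
    · rw [cls_res, hP, Function.iterate_succ_apply']
    · simpa [Set.image_image, add_assoc, add_comm 1 k] using h₁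
    · simpa [Set.image_image, add_assoc, add_comm 1 k] using h₂

theorem exposesBarb_iterate {k : ℕ} {e : Set ℕ × Set ℕ} {p : Pat} {A B : Proc}
    (h₁ : p.pn ⊆ (· + k) '' e.1) (h₂ : p.fn ∩ (· + k) '' e.1 = (· + k) '' e.2) :
    ∃ R, ExposesBarb e (Proc.res^[k] (.par (.case p A) B)) R := by
  induction k generalizing e with
  | zero => exact ⟨_, .parL _ (.case ⟨rfl, _, _, rfl, by simpa using h₁, by simpa using h₂⟩)⟩
  | succ k ih =>
    rw [Function.iterate_succ_apply']
    obtain ⟨R, h⟩ := ih (e := Prod.map (Set.image (· + 1)) (Set.image (· + 1)) e)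
      (by simpa [Set.image_image, add_assoc, add_comm 1 k] using h₁)
      (by simpa [Set.image_image, add_assoc, add_comm 1 k] using h₂)
    exact ⟨_, h.res⟩

/-- At the top all names are public; below `k` restrictions the public ones are the indices from `k`
on. The condition on protected names and the set of free names then match the two clauses of
`ShowsBarb`. -/
theorem barb_iff {P : Proc} {m : Set ℕ} : Barb P m ↔ ∃ R, ExposesBarb (Set.univ, m) P R := by
  have hr : ∀ k : ℕ, (· + k) '' (Set.univ : Set ℕ) = {i | k ≤ i} := by
    intro k
    ext i
    simp only [Set.image_univ, Set.mem_range, Set.mem_ofPred_eq]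
    exact ⟨fun ⟨j, hj⟩ => by omega, fun h => ⟨i - k, by omega⟩⟩
  constructor
  · rintro ⟨k, p, A, B, hP, hp, rfl⟩
    obtain ⟨R, h⟩ := exposesBarb_iterate (k := k) (e := (Set.univ, {i | i + k ∈ p.fn})) (p := p)
      (A := A) (B := B) (by rw [hr]; exact hp) (by
        rw [hr]
        ext i
        constructor
        · rintro ⟨h, hi⟩
          exact ⟨i - k, by simpa [Nat.sub_add_cancel hi] using h, Nat.sub_add_cancel hi⟩
        · rintro ⟨j, hj, rfl⟩
          exact ⟨hj, Nat.le_add_left _ _⟩)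
    obtain ⟨R', h, _⟩ := (natural_showsBarb False).expose_gcong (hP.gcong False).symm h
    exact ⟨R', h⟩
  · rintro ⟨R, h⟩
    obtain ⟨k, p, A, B, hP, h₁, h₂⟩ := h.cong (g := False)
    rw [← cls_par, ← cls_iterate_res] at hP
    refine ⟨k, p, A, B, (cls_eq.1 hP).cong, ?_, ?_⟩
    · rw [hr] at h₁
      exact h₁
    · ext i
      have := Set.ext_iff.1 h₂ (i + k)
      simpa using this.symm

theorem GCong.barb {P Q : Proc} {m : Set ℕ} (h : GCong g P Q) (h' : Barb P m) : Barb Q m := by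
  rw [barb_iff] at h' ⊢
  obtain ⟨R, h'⟩ := h'
  obtain ⟨R', h', _⟩ := (natural_showsBarb g).expose_gcong h h'
  exact ⟨R', h'⟩

/-- The base relation for success. -/
def ShowsOk (_ : Unit) (T R : Proc) : Prop := R = .nil ∧ T = .ok

theorem natural_showsOk (g : Prop) : Natural g (fun _ => id) ShowsOk where
  ren_id _ := rfl
  ren_ren _ _ _ := rfl
  gcong := by
    rintro e p A B R h ⟨_, h⟩
    cases h
  rename := by
    rintro f e T R hf ⟨rfl, rfl⟩
    exact ⟨rfl, rfl⟩
  of_rename := by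
    rintro f e T R hf ⟨rfl, hT⟩
    cases T <;> simp [Proc.rename, Proc.subst] at hT
    exact ⟨.nil, rfl, rfl, rfl⟩
  dead := by
    rintro f i e p A R hi ⟨_, h⟩
    cases h

/-- The process `P` has an unguarded success process. -/
abbrev ExposesOk (P R : Proc) : Prop := Expose (fun _ => id) ShowsOk () P R

/-- The residual is `P` with the exposed success process replaced by null. The success process has
no names, so it can leave every scope and be put back outside. -/
theorem ExposesOk.eq_mul {P R : Proc} (h : ExposesOk P R) :
    cls g P = cls g R * cls g .ok := by
  unfold ExposesOk at h
  generalize () = e at h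
  induction h with
  | ok h =>
    obtain ⟨rfl, _⟩ := h
    simp
  | case h =>
    obtain ⟨_, h⟩ := h
    cases h
  | parL Q _ ih => simp only [cls_par, ih]; ac_rfl
  | parR Q _ ih => simp only [cls_par, ih]; ac_rfl
  | repl _ ih =>
    rw [cls_repl, repl_eq, ih, cls_par, cls_repl, ih]
    ac_rfl
  | res _ ih =>
    rw [cls_res, ih, cls_res]
    exact res_mul_rename .ok _

theorem cong_par_ok_iff {P : Proc} : (∃ Q, Cong P (.par Q .ok)) ↔ ∃ R, ExposesOk P R := by
  constructor
  · rintro ⟨Q, h⟩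
    obtain ⟨R, h, _⟩ := (natural_showsOk False).expose_gcong (h.gcong False).symm
      (e := ()) (.parR Q (.ok ⟨rfl, rfl⟩))
    exact ⟨R, h⟩
  · rintro ⟨R, h⟩
    exact ⟨R, (cls_eq.1 (h.eq_mul (g := False))).cong⟩

theorem GCong.exists_cong_par_ok {P Q : Proc} (h : GCong g P Q)
    (h' : ∃ P', Cong P (.par P' .ok)) : ∃ Q', Cong Q (.par Q' .ok) := by
  rw [cong_par_ok_iff] at h' ⊢
  obtain ⟨R, h'⟩ := h'
  obtain ⟨R', h', _⟩ := (natural_showsOk g).expose_gcong h h'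
  exact ⟨R', h'⟩

/-! ### Barbed congruence -/

theorem GCong.plug {P Q : Proc} (h : GCong g P Q) (C : Ctx) :
    GCong g (C.plug fun _ => P) (C.plug fun _ => Q) := by
  induction C with
  | hole i => exact h
  | nil => exact .refl _
  | ok => exact .refl _
  | par C D hC hD => exact hC.par hD
  | repl C hC => exact hC.repl
  | res x C hC => exact (hC.rename _).res
  | case p xs hx C hC => exact (hC.rename _).case p

/-- `GCong g` is itself the relation required by the definition of barbed congruence. -/
theorem GCong.barbedCong {P Q : Proc} (h : GCong g P Q) : BarbedCong P Q :=
  ⟨GCong g, fun _ _ h => h.symm, fun _ _ _ h h' => h.barb h', fun _ _ _ h h' => h.red h',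
    fun _ _ C h _ => h.plug C, h⟩

end CPC

namespace CPC

/-! ### Unification and interaction of the patterns that occur in encodings. -/

theorem inst_nil : inst [] = Comm.name := rfl

theorem Unify.bind_toPat {c : Comm} {σ ρ : List Comm} (h : Unify .bind c.toPat σ ρ) :
    σ = [c] ∧ ρ = [] := by
  generalize hq : c.toPat = q at h
  cases h with
  | bind_left _ d h => exact ⟨by rw [Comm.toPat_injective (hq.trans h)], rfl⟩
  | bind_right => cases c <;> cases hq

theorem res_dead (p : Pat) (P : Proc) : (cls True (.case (.comp (.prot 0) p) P)).res = 1 :=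
  (GCong.dead trivial p P).eq

theorem Unify.eq_of_prot_toPat {n : ℕ} {c : Comm} {σ ρ : List Comm}
    (h : Unify (.prot n) c.toPat σ ρ) : c = .name n ∧ σ = [] ∧ ρ = [] := by
  cases c with
  | name m => cases h; simp
  | comp c d => cases h

theorem Interact.of_case {p q : Pat} {A B R : Proc} (h : Interact (.case p A) (.case q B) R) :
    ∃ σ ρ, Unify p q σ ρ ∧ R = .par (A.subst (inst σ)) (B.subst (inst ρ)) := by
  cases h with
  | case h =>
    cases h with
    | case h =>
      obtain ⟨_, _, _, _, σ, ρ, h₁, h₂, hu, rfl⟩ := h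
      cases h₁
      cases h₂
      exact ⟨σ, ρ, hu, rfl⟩

theorem Interact.case {p q : Pat} {A B : Proc} {σ ρ : List Comm} (h : Unify p q σ ρ) :
    Interact (.case p A) (.case q B) (.par (A.subst (inst σ)) (B.subst (inst ρ))) :=
  Expose.case (Expose.case ⟨_, _, _, _, _, _, rfl, rfl, h, rfl⟩)

theorem liftSubst_zero (f : ℕ → Comm) : liftSubst 0 f = f := by
  funext i
  have : ∀ c : Comm, c.rename (· + 0) = c := fun c => by
    rw [Comm.rename_eq_subst]; exact Comm.subst_name c
  simp only [liftSubst, not_lt_zero, if_false, Nat.sub_zero, this]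

end CPC

namespace Spi

/-! ### Substitution and structural congruence in the Spi calculus -/

theorem Term.subst_name (M : Term) : M.subst .name = M := by
  induction M with
  | name n => rfl
  | pair M N hM hN => simp [subst, hM, hN]
  | zero => rfl
  | suc M hM => simp [subst, hM]
  | encr M N hM hN => simp [subst, hM, hN]

theorem Term.rename_rename (f h : ℕ → ℕ) (M : Term) :
    (M.rename f).rename h = M.rename (h ∘ f) := by
  simp only [rename]
  induction M with
  | name n => rfl
  | pair M N hM hN => simp [subst, hM, hN]
  | zero => rfl
  | suc M hM => simp [subst, hM]
  | encr M N hM hN => simp [subst, hM, hN]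

theorem liftSubst_id (k : ℕ) : liftSubst k Term.name = Term.name := by
  funext i
  simp only [liftSubst]
  split_ifs with h
  · rfl
  · simp only [Term.rename, Term.subst]; congr 1; omega

theorem liftSubst_name (k : ℕ) (f : ℕ → ℕ) :
    (liftSubst k fun n => .name (f n)) = fun n => .name (liftRenaming k f n) := by
  funext i
  simp only [liftSubst, liftRenaming]
  split_ifs <;> rfl

theorem liftRenaming_comp (k : ℕ) (f h : ℕ → ℕ) :
    liftRenaming k h ∘ liftRenaming k f = liftRenaming k (h ∘ f) := by
  funext i
  simp only [Function.comp, liftRenaming]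
  split_ifs with h₁ h₂
  · rfl
  · omega
  · simp

theorem Proc.subst_name (P : Proc) : P.subst .name = P := by
  induction P <;> simp_all [subst, liftSubst_id, Term.subst_name]

theorem Proc.rename_rename (f h : ℕ → ℕ) (P : Proc) :
    (P.rename f).rename h = P.rename (h ∘ f) := by
  have ht := Term.rename_rename
  have hl : ∀ k f h i,
      liftRenaming k h (liftRenaming k f i) = liftRenaming k (fun n => h (f n)) i :=
    fun k f h => congrFun (liftRenaming_comp k f h)
  simp only [Term.rename, Function.comp_def] at ht
  simp only [rename, Function.comp_def]
  induction P generalizing f h <;> simp_all [subst, liftSubst_name]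

/-- The setoid of structural congruence. -/
def congSetoid : Setoid Proc := ⟨Cong, .refl, .symm, .trans⟩

/-- Processes up to structural congruence. -/
def CClass : Type := Quotient congSetoid

/-- The class of a process. -/
def cls (P : Proc) : CClass := Quotient.mk congSetoid P

theorem cls_eq {P Q : Proc} : cls P = cls Q ↔ Cong P Q :=
  ⟨fun h => Quotient.exact (s := congSetoid) h, fun h => Quotient.sound (s := congSetoid) h⟩

theorem Cong.eq {P Q : Proc} (h : Cong P Q) : cls P = cls Q := cls_eq.2 h

/-- Restriction on classes. -/
def CClass.res : CClass → CClass :=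
  Quotient.map' (s₁ := congSetoid) (s₂ := congSetoid) Proc.res fun _ _ h => h.res

/-- Replication on classes. -/
def CClass.repl : CClass → CClass :=
  Quotient.map' (s₁ := congSetoid) (s₂ := congSetoid) Proc.repl fun _ _ h => h.repl

instance : CommMonoid CClass where
  mul := Quotient.map₂ (sa := congSetoid) (sb := congSetoid) (sc := congSetoid) Proc.par
    fun _ _ h _ _ h' => h.par h'
  one := cls .nil
  mul_assoc := by rintro ⟨P⟩ ⟨Q⟩ ⟨R⟩; exact (Cong.par_assoc P Q R).symm.eq
  one_mul := by rintro ⟨P⟩; exact ((Cong.par_comm _ _).trans (Cong.par_nil P)).eq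
  mul_one := by rintro ⟨P⟩; exact (Cong.par_nil P).eq
  mul_comm := by rintro ⟨P⟩ ⟨Q⟩; exact (Cong.par_comm P Q).eq

@[simp]
theorem cls_par (P Q : Proc) : cls (.par P Q) = cls P * cls Q := rfl

@[simp]
theorem cls_nil : cls .nil = 1 := rfl

@[simp]
theorem cls_res (P : Proc) : cls (.res P) = (cls P).res := rfl

@[simp]
theorem cls_repl (P : Proc) : cls (.repl P) = (cls P).repl := rfl

theorem repl_eq (c : CClass) : c.repl = c * c.repl := by
  obtain ⟨P⟩ := c; exact (Cong.repl_unfold P).eq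

theorem res_mul_rename (P : Proc) (c : CClass) :
    (c * cls (P.rename (· + 1))).res = c.res * cls P := by
  rw [mul_comm, mul_comm _ (cls P)]
  obtain ⟨Q⟩ := c
  exact (Cong.par_res P Q).symm.eq

theorem cls_iterate_res (k : ℕ) (P : Proc) : cls (Proc.res^[k] P) = CClass.res^[k] (cls P) :=
  Function.Semiconj.iterate_right (f := cls) (ga := Proc.res) (gb := CClass.res)
    (fun _ => rfl) k P

theorem iterate_res_mul (k : ℕ) (P : Proc) (c : CClass) :
    CClass.res^[k] (c * cls (P.rename (· + k))) = CClass.res^[k] c * cls P := by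
  induction k generalizing c P with
  | zero => rw [show P.rename (· + 0) = P from Proc.subst_name P]; rfl
  | succ k ih =>
    rw [Function.iterate_succ_apply, Function.iterate_succ_apply]
    rw [show P.rename (· + (k + 1)) = (P.rename (· + k)).rename (· + 1) by
      rw [Proc.rename_rename]; rfl, res_mul_rename, ih]

theorem Red.of_eq {P Q R S : Proc} (h : cls P = cls Q) (h' : Red Q R) (h'' : cls R = cls S) :
    Red P S := .struct (cls_eq.1 h) h' (cls_eq.1 h'')

theorem Red.iterate_res {P Q : Proc} (h : Red P Q) (k : ℕ) :
    Red (Proc.res^[k] P) (Proc.res^[k] Q) := by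
  induction k with
  | zero => exact h
  | succ k ih => rw [Function.iterate_succ_apply', Function.iterate_succ_apply']; exact ih.res

/-! ### Encoding and substitution -/

/-- The names chosen for the encoding are distinct. -/
structure Admissible (ι : ℕ → ℕ) (τ : Tag → ℕ) : Prop where
  inj : Function.Injective ι
  tag_inj : Function.Injective τ
  ne : ∀ a t, ι a ≠ τ t

variable {ι ι' : ℕ → ℕ} {τ τ' : Tag → ℕ}

theorem Admissible.shift (h : Admissible ι τ) (k : ℕ) : Admissible (ι · + k) (τ · + k) where
  inj := (add_left_injective k).comp h.inj
  tag_inj := (add_left_injective k).comp h.tag_inj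
  ne a t e := h.ne a t (Nat.add_right_cancel e)

theorem Admissible.lift (h : Admissible ι τ) (k : ℕ) :
    Admissible (liftRenaming k ι) (τ · + k) where
  inj := liftRenaming_injective k h.inj
  tag_inj := (add_left_injective k).comp h.tag_inj
  ne a t e := add_notMem_range_liftRenaming (f := ι) (i := τ t) k
    (fun ⟨b, hb⟩ => h.ne b t hb) ⟨a, e⟩

/-- Names and zero differ because `ι` avoids `τ`; a successor and a binary constructor differ in the
shape of the left component; pairs and encryptions differ by their tags. -/
theorem Term.encode_injective (h : Admissible ι τ) : Function.Injective (Term.encode ι τ) := by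
  intro M
  induction M with
  | name n =>
    intro N e
    cases N with
    | name m => simp only [encode, CPC.Comm.name.injEq] at e; rw [h.inj e]
    | zero => simp only [encode, CPC.Comm.name.injEq] at e; exact (h.ne _ _ e).elim
    | _ => cases e
  | zero =>
    intro N e
    cases N with
    | name m => simp only [encode, CPC.Comm.name.injEq] at e; exact (h.ne _ _ e.symm).elim
    | zero => rfl
    | _ => cases e
  | suc M hM =>
    intro N e
    cases N with
    | suc N => simp only [encode, CPC.Comm.comp.injEq] at e; rw [hM e.2]
    | _ => simp [encode] at e
  | pair M N hM hN =>
    intro K e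
    cases K with
    | pair M' N' => simp only [encode, CPC.Comm.comp.injEq] at e; rw [hM e.1.2, hN e.2]
    | encr M' N' =>
      simp only [encode, CPC.Comm.comp.injEq, CPC.Comm.name.injEq] at e
      cases h.tag_inj e.1.1
    | _ => simp [encode] at e
  | encr M N hM hN =>
    intro K e
    cases K with
    | encr M' N' => simp only [encode, CPC.Comm.comp.injEq] at e; rw [hM e.1.2, hN e.2]
    | pair M' N' =>
      simp only [encode, CPC.Comm.comp.injEq, CPC.Comm.name.injEq] at e
      cases h.tag_inj e.1.1
    | _ => simp [encode] at e

/-- On encodings of names in `s`, the CPC substitution `φ` acts as the Spi substitution `f`. -/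
structure Simulates (s : Set ℕ) (ι : ℕ → ℕ) (τ : Tag → ℕ) (ι' : ℕ → ℕ) (τ' : Tag → ℕ)
    (f : ℕ → Term) (φ : ℕ → CPC.Comm) : Prop where
  name : ∀ a ∈ s, φ (ι a) = (f a).encode ι' τ'
  tag : ∀ t, φ (τ t) = .name (τ' t)

variable {s t : Set ℕ} {f : ℕ → Term} {φ : ℕ → CPC.Comm}

theorem Simulates.mono (h : Simulates s ι τ ι' τ' f φ) (hs : t ⊆ s) :
    Simulates t ι τ ι' τ' f φ :=
  ⟨fun a ha => h.name a (hs ha), h.tag⟩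

theorem Term.encode_subst {M : Term} (h : Simulates M.fn ι τ ι' τ' f φ) :
    (M.encode ι τ).subst φ = (M.subst f).encode ι' τ' := by
  induction M with
  | name n => exact h.name n rfl
  | zero => exact h.tag _
  | suc M hM =>
    have := h.tag
    simp [encode, subst, CPC.Comm.subst, hM h, this]
  | pair M N hM hN =>
    have := h.tag
    simp [encode, subst, CPC.Comm.subst, hM (h.mono Set.subset_union_left),
      hN (h.mono Set.subset_union_right), this]
  | encr M N hM hN =>
    have := h.tag
    simp [encode, subst, CPC.Comm.subst, hM (h.mono Set.subset_union_left),
      hN (h.mono Set.subset_union_right), this]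

theorem Term.encode_toPat_subst {M : Term} (h : Simulates M.fn ι τ ι' τ' f φ) :
    (M.encode ι τ).toPat.subst φ = ((M.subst f).encode ι' τ').toPat := by
  rw [CPC.Comm.subst_toPat, encode_subst h]

theorem Term.encode_rename_add (k : ℕ) (M : Term) :
    (M.encode ι τ).rename (· + k) = M.encode (ι · + k) (τ · + k) := by
  rw [CPC.Comm.rename_eq_subst, encode_subst (φ := fun n => .name (n + k)) (f := .name)
    ⟨fun _ _ => rfl, fun _ => rfl⟩, subst_name]

theorem Term.rename_encode_lift (k : ℕ) (M : Term) :
    (M.rename (· + k)).encode (liftRenaming k ι) (τ · + k) = (M.encode ι τ).rename (· + k) := by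
  rw [CPC.Comm.rename_eq_subst]
  exact (encode_subst (φ := fun n => .name (n + k)) (f := fun n => .name (n + k))
    ⟨fun _ _ => by simp [Term.encode], fun _ => rfl⟩).symm

/-- For binders that both calculi share. -/
theorem Simulates.lift {k : ℕ} (h : Simulates {n | n + k ∈ s} ι τ ι' τ' f φ) :
    Simulates s (liftRenaming k ι) (τ · + k) (liftRenaming k ι') (τ' · + k) (liftSubst k f)
      (CPC.liftSubst k φ) where
  name a ha := by
    rcases lt_or_ge a k with hk | hk
    · rw [liftRenaming_lt _ hk, CPC.liftSubst_lt _ hk, liftSubst, if_pos hk, Term.encode,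
        liftRenaming_lt _ hk]
    · obtain ⟨b, rfl⟩ := Nat.exists_eq_add_of_le' hk
      rw [liftRenaming_add, CPC.liftSubst_add, h.name b ha]
      simp [liftSubst, Term.rename_encode_lift]
  tag t := by rw [CPC.liftSubst_add, h.tag]; rfl

/-- For binders that exist only in CPC, such as the fresh name of a destructor or the dummy binding
name of an output: the Spi substitution is left as it is. -/
theorem Simulates.shift (h : Simulates s ι τ ι' τ' f φ) (k : ℕ) :
    Simulates s (ι · + k) (τ · + k) (ι' · + k) (τ' · + k) f (CPC.liftSubst k φ) where
  name a ha := by rw [CPC.liftSubst_add, h.name a ha, Term.encode_rename_add]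
  tag t := by rw [CPC.liftSubst_add, h.tag]; rfl

/-- One substitution lemma for all later purposes: shifts, instantiations after a reduction, name
substitutions and the closing of names are obtained by choosing `f` and `φ`. -/
theorem Proc.encode_subst {P : Proc} (h : Simulates P.fn ι τ ι' τ' f φ) :
    (P.encode ι τ).subst φ = (P.subst f).encode ι' τ' := by
  -- Below the restriction of a destructor the index `0` is the private name, which no lifted
  -- substitution touches.
  have h0 : CPC.liftSubst 1 φ 0 = .name 0 := rfl
  induction P generalizing ι τ ι' τ' f φ with
  | nil => rfl
  | ok => rfl
  | par P Q hP hQ =>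
    simp [encode, subst, CPC.Proc.subst, hP (h.mono Set.subset_union_left) rfl,
      hQ (h.mono Set.subset_union_right) rfl]
  | repl P hP => simp [encode, subst, CPC.Proc.subst, hP h rfl]
  | res P hP => simp [encode, subst, CPC.Proc.subst, hP (Simulates.lift h) rfl]
  | inp M P hP =>
    have hM := Term.encode_toPat_subst (h.mono (Set.subset_union_left : M.fn ⊆ _))
    have hP := hP (Simulates.lift (k := 1) (h.mono Set.subset_union_right)) rfl
    simp [encode, subst, CPC.Proc.subst, CPC.Pat.subst, CPC.Pat.binders, CPC.Comm.toPat, hM, hP,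
      h.tag]
  | out M N P hP =>
    have hM := Term.encode_toPat_subst
      (h.mono (Set.subset_union_left.trans Set.subset_union_left : M.fn ⊆ _))
    have hN := Term.encode_toPat_subst
      (h.mono (Set.subset_union_right.trans Set.subset_union_left : N.fn ⊆ _))
    have hP := hP ((h.mono Set.subset_union_right).shift 1) rfl
    simp [encode, subst, CPC.Proc.subst, CPC.Pat.subst, CPC.Pat.binders, hM, hN, hP]
  | test M N P hP =>
    have h := h.shift 1
    have hM := Term.encode_toPat_subst
      (h.mono (Set.subset_union_left.trans Set.subset_union_left : M.fn ⊆ _))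
    have hN := Term.encode_toPat_subst
      (h.mono (Set.subset_union_right.trans Set.subset_union_left : N.fn ⊆ _))
    have hP := hP (h.mono Set.subset_union_right) rfl
    simp [encode, subst, CPC.Proc.subst, CPC.Pat.subst, CPC.Pat.binders, h0,
      CPC.Comm.protect, hM, hN, hP, CPC.liftSubst_zero]
  | split M P hP =>
    have h := h.shift 1
    have hM := Term.encode_toPat_subst (h.mono (Set.subset_union_left : M.fn ⊆ _))
    have hP := hP (Simulates.lift (k := 2) (h.mono Set.subset_union_right)) rfl
    simp [encode, subst, CPC.Proc.subst, CPC.Pat.subst, CPC.Pat.binders, h0,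
      CPC.Comm.protect, hM, hP, h.tag]
  | decrypt M N P hP =>
    have h := h.shift 1
    have hM := Term.encode_toPat_subst
      (h.mono (Set.subset_union_left.trans Set.subset_union_left : M.fn ⊆ _))
    have hN := Term.encode_toPat_subst
      (h.mono (Set.subset_union_right.trans Set.subset_union_left : N.fn ⊆ _))
    have hP := hP (Simulates.lift (k := 1) (h.mono Set.subset_union_right)) rfl
    simp [encode, subst, CPC.Proc.subst, CPC.Pat.subst, CPC.Pat.binders, h0,
      CPC.Comm.protect, hM, hN, hP, h.tag]
  | intCase M P Q hP hQ =>
    have h := h.shift 1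
    have hM := Term.encode_toPat_subst
      (h.mono (Set.subset_union_left.trans Set.subset_union_left : M.fn ⊆ _))
    have hP := hP (h.mono (Set.subset_union_right.trans Set.subset_union_left : P.fn ⊆ _)) rfl
    have hQ := hQ (Simulates.lift (k := 1) (h.mono Set.subset_union_right)) rfl
    simp [encode, subst, CPC.Proc.subst, CPC.Pat.subst, CPC.Pat.binders, h0,
      CPC.Comm.protect, hM, hP, hQ, h.tag, CPC.liftSubst_zero]

theorem Proc.encode_rename {k : ℕ → ℕ} {l : ℕ → ℕ} (P : Proc) (h : ∀ a ∈ P.fn, l (ι a) = ι' (k a))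
    (h' : ∀ t, l (τ t) = τ' t) : (P.encode ι τ).rename l = (P.rename k).encode ι' τ' :=
  encode_subst ⟨fun a ha => congrArg CPC.Comm.name (h a ha), fun t => congrArg _ (h' t)⟩

theorem Proc.encode_rename_add_lift (k : ℕ) (P : Proc) :
    (P.encode ι τ).rename (· + k) =
      (P.rename (· + k)).encode (liftRenaming k ι) (τ · + k) :=
  encode_rename P (fun a _ => (liftRenaming_add k a ι).symm) fun _ => rfl

theorem Proc.rename_id (P : Proc) : P.rename id = P := subst_name P

theorem Proc.encode_rename_add (k : ℕ) (P : Proc) :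
    (P.encode ι τ).rename (· + k) = P.encode (ι · + k) (τ · + k) := by
  rw [encode_rename (k := id) (ι' := (ι · + k)) (τ' := (τ · + k)) P (fun _ _ => rfl)
    (fun _ => rfl), rename_id]

theorem Proc.encode_subst_inst (σ : List Term) (P : Proc) :
    (P.encode (liftRenaming σ.length ι) (τ · + σ.length)).subst
      (CPC.inst (σ.map (Term.encode ι τ))) = (P.subst (inst σ)).encode ι τ := by
  refine encode_subst ⟨fun a _ => ?_, fun t => ?_⟩
  · simp only [liftRenaming, CPC.inst, inst, List.length_map]
    split_ifs with h
    · simp [h]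
    · simp [not_lt.1 h, Term.encode]
  · simp [CPC.inst]

/-- Binders that are absent in Spi are instantiated without effect, whatever the values are. This
discards the name `in` received by an output. -/
theorem Proc.encode_subst_inst_shift (σ : List CPC.Comm) (P : Proc) :
    (P.encode (ι · + σ.length) (τ · + σ.length)).subst (CPC.inst σ) = P.encode ι τ := by
  rw [encode_subst (f := .name) (ι' := ι) (τ' := τ) (φ := CPC.inst σ), subst_name]
  exact ⟨fun a _ => by simp [CPC.inst, Term.encode], fun t => by simp [CPC.inst]⟩

theorem Cong.encode {P Q : Proc} (h : Cong P Q) (ι : ℕ → ℕ) (τ : Tag → ℕ) :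
    CPC.Cong (P.encode ι τ) (Q.encode ι τ) := by
  induction h generalizing ι τ with
  | par_nil P => exact .par_nil _
  | par_comm P Q => exact .par_comm _ _
  | par_assoc P Q R => exact .par_assoc _ _ _
  | res_nil => exact .res_nil
  | res_res P =>
    have := CPC.Cong.res_res (P.encode (liftRenaming 1 (liftRenaming 1 ι)) (τ · + 1 + 1))
    rwa [Proc.encode_rename (k := Equiv.swap 0 1)
      (ι' := liftRenaming 1 (liftRenaming 1 ι)) (τ' := (τ · + 1 + 1))] at this
    · rintro (_ | _ | a) _
      · simp [liftRenaming]
      · simp [liftRenaming]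
      · rw [swap_zero_one_add_two, show a + 2 = a + 1 + 1 from rfl, liftRenaming_add,
          liftRenaming_add]
        exact swap_zero_one_add_two _
    · exact fun t => swap_zero_one_add_two _
  | repl_unfold P => exact .repl_unfold _
  | par_res P Q =>
    have := CPC.Cong.par_res (P.encode ι τ) (Q.encode (liftRenaming 1 ι) (τ · + 1))
    rwa [Proc.encode_rename_add_lift] at this
  | refl P => exact .refl _
  | symm _ ih => exact (ih ι τ).symm
  | trans _ _ ih₁ ih₂ => exact (ih₁ ι τ).trans (ih₂ ι τ)
  | par _ _ ih₁ ih₂ => exact (ih₁ ι τ).par (ih₂ ι τ)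
  | repl _ ih => exact (ih ι τ).repl
  | res _ ih => exact (ih _ _).res
  | inp M _ ih => exact (ih _ _).case _
  | out M N _ ih => exact (ih _ _).case _
  | test M N _ ih => exact (((ih _ _).case _).par (.refl _)).res
  | split M _ ih => exact (((ih _ _).case _).par (.refl _)).res
  | decrypt M N _ ih => exact (((ih _ _).case _).par (.refl _)).res
  | intCase M _ _ ih₁ ih₂ =>
    exact (((ih₁ _ _).case _).par (((ih₂ _ _).case _).par (.refl _))).res

/-! ### Exposed threads of encodings -/

/-- Inputs, outputs and the success process. -/
inductive IsThread : Proc → Prop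
  | ok : IsThread .ok
  | inp (M : Term) (P : Proc) : IsThread (.inp M P)
  | out (M N : Term) (P : Proc) : IsThread (.out M N P)

theorem IsThread.rename {T : Proc} (h : IsThread T) (f : ℕ → ℕ) : IsThread (T.rename f) := by
  cases h <;> constructor

theorem Proc.encode_iterate_res (k : ℕ) (P : Proc) :
    (res^[k] P).encode ι τ =
      CPC.Proc.res^[k] (P.encode (liftRenaming k ι) (τ · + k)) := by
  induction k generalizing ι τ with
  | zero => simp [liftRenaming_zero]
  | succ k ih =>
    rw [Function.iterate_succ_apply', Function.iterate_succ_apply', encode, ih,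
      liftRenaming_liftRenaming]
    simp only [add_assoc, add_comm 1 k]

/-- Whatever an encoding exposes comes from a thread of the Spi process, which can be brought into
prenex form around that thread. In the destructor clauses all cases protect the private name and are
ruled out by `Natural.dead`. -/
theorem exists_of_expose_encode {g : Prop} {E : Type} {ren : (ℕ → ℕ) → E → E}
    {K : E → CPC.Proc → CPC.Proc → Prop} (hK : CPC.Natural g ren K) {P : Proc} {e : E}
    {R : CPC.Proc} (h : CPC.Expose ren K e (P.encode ι τ) R) :
    ∃ j T S R₀, IsThread T ∧ cls P = CClass.res^[j] (cls T * cls S) ∧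
      K (ren (· + j) e) (T.encode (liftRenaming j ι) (τ · + j)) R₀ ∧
      CPC.cls g R = CPC.GClass.res^[j]
        (CPC.cls g R₀ * CPC.cls g (S.encode (liftRenaming j ι) (τ · + j))) := by
  have h0 : ∀ {ι τ e R} {T : Proc}, IsThread T → K e (T.encode ι τ) R →
      ∃ j T' S R₀, IsThread T' ∧ cls T = CClass.res^[j] (cls T' * cls S) ∧
      K (ren (· + j) e) (T'.encode (liftRenaming j ι) (τ · + j)) R₀ ∧
      CPC.cls g R = CPC.GClass.res^[j]
        (CPC.cls g R₀ * CPC.cls g (S.encode (liftRenaming j ι) (τ · + j))) := by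
    intro ι τ e R T hT h
    refine ⟨0, T, .nil, R, hT, by simp, ?_, by simp [Proc.encode]⟩
    rw [show (· + 0) = id from rfl, hK.ren_id, liftRenaming_zero]
    exact h
  have hd : ∀ {e : E} {p A R},
      ¬ CPC.Expose ren K (ren (· + 1) e) (.case (.comp (.prot 0) p) A) R := by
    intro e p A R h
    cases h with
    | case h => exact hK.dead (by simp) h
  induction P generalizing ι τ e R with
  | nil => cases h
  | ok =>
    cases h with
    | ok h => exact h0 .ok h
  | par P Q hP hQ =>
    cases h with
    | parL _ h =>
      obtain ⟨j, T, S, R₀, hT, hc, h₁, h₂⟩ := hP h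
      refine ⟨j, T, .par S (Q.rename (· + j)), R₀, hT, ?_, h₁, ?_⟩
      · rw [cls_par, cls_par, ← mul_assoc, iterate_res_mul, hc]
      · rw [Proc.encode, CPC.cls_par, CPC.cls_par, ← Proc.encode_rename_add_lift, ← mul_assoc,
          CPC.iterate_res_mul, h₂]
    | parR _ h =>
      obtain ⟨j, T, S, R₀, hT, hc, h₁, h₂⟩ := hQ h
      refine ⟨j, T, .par S (P.rename (· + j)), R₀, hT, ?_, h₁, ?_⟩
      · rw [cls_par, cls_par, ← mul_assoc, iterate_res_mul, hc, mul_comm]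
      · rw [Proc.encode, CPC.cls_par, CPC.cls_par, ← Proc.encode_rename_add_lift, ← mul_assoc,
          CPC.iterate_res_mul, h₂, mul_comm]
  | repl P hP =>
    cases h with
    | repl h =>
      obtain ⟨j, T, S, R₀, hT, hc, h₁, h₂⟩ := hP h
      refine ⟨j, T, .par S ((Proc.repl P).rename (· + j)), R₀, hT, ?_, h₁, ?_⟩
      · rw [cls_par, ← mul_assoc, iterate_res_mul, ← hc, cls_repl, ← repl_eq]
      · rw [Proc.encode, CPC.cls_par, CPC.cls_par, ← Proc.encode_rename_add_lift, ← mul_assoc,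
          CPC.iterate_res_mul, h₂, Proc.encode]
  | res P hP =>
    cases h with
    | res h =>
      obtain ⟨j, T, S, R₀, hT, hc, h₁, h₂⟩ := hP h
      have e₁ : (fun t => τ t + 1 + j) = (τ · + (j + 1)) := funext fun t => by omega
      have e₂ : ((· + j) ∘ (· + 1) : ℕ → ℕ) = (· + (j + 1)) := funext fun i => by simp; omega
      rw [liftRenaming_liftRenaming, e₁] at h₁ h₂
      rw [hK.ren_ren, e₂] at h₁
      refine ⟨j + 1, T, S, R₀, hT, ?_, h₁, ?_⟩
      · rw [cls_res, hc, Function.iterate_succ_apply']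
      · rw [CPC.cls_res, h₂, Function.iterate_succ_apply']
  | inp M P hP =>
    cases h with
    | case h => exact h0 (.inp M P) h
  | out M N P hP =>
    cases h with
    | case h => exact h0 (.out M N P) h
  | test M N P hP =>
    cases h with
    | res h =>
      cases h with
      | parL _ h => exact (hd h).elim
      | parR _ h => exact (hd h).elim
  | split M P hP =>
    cases h with
    | res h =>
      cases h with
      | parL _ h => exact (hd h).elim
      | parR _ h => exact (hd h).elim
  | decrypt M N P hP =>
    cases h with
    | res h =>
      cases h with
      | parL _ h => exact (hd h).elim
      | parR _ h => exact (hd h).elim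
  | intCase M P Q hP hQ =>
    cases h with
    | res h =>
      cases h with
      | parL _ h => exact (hd h).elim
      | parR _ h =>
        cases h with
        | parL _ h => exact (hd h).elim
        | parR _ h => exact (hd h).elim

theorem exists_red_of_react_encode {g : Prop} (h : Admissible ι τ) {U T : Proc} {R : CPC.Proc}
    (hU : IsThread U) (hT : IsThread T) (hr : CPC.React (U.encode ι τ) (T.encode ι τ) R) :
    ∃ R', Red (.par T U) R' ∧ CPC.cls g R = CPC.cls g (R'.encode ι τ) := by
  have hb : ∀ {σ ρ}, ¬ CPC.Unify .bind .bind σ ρ := by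
    intro σ ρ hu
    cases hu with
    | bind_left _ c h => cases c <;> cases h
    | bind_right _ c h => cases c <;> cases h
  have key : ∀ {M N P M' Q σ ρ}, CPC.Unify
      (.comp (.comp (Term.encode ι τ M).toPat .bind) (.var (τ .input)))
      (.comp (.comp (Term.encode ι τ M').toPat (Term.encode ι τ N).toPat) .bind) σ ρ →
      Red (.par (.inp M P) (.out M' N Q)) (.par (P.subst (inst [N])) Q) ∧
      (P.encode (liftRenaming 1 ι) (τ · + 1)).subst (CPC.inst σ) =
        (P.subst (inst [N])).encode ι τ ∧
      (Q.encode (ι · + 1) (τ · + 1)).subst (CPC.inst ρ) = Q.encode ι τ := by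
    intro M N P M' Q σ ρ hu
    cases hu with
    | comp h₁ h₂ =>
      cases h₁ with
      | comp h₁ h₃ =>
        obtain ⟨hM, rfl, rfl⟩ := CPC.Unify.toPat_iff.1 h₁
        obtain ⟨rfl, rfl⟩ := h₃.bind_toPat
        obtain ⟨rfl, rfl⟩ := CPC.Unify.bind_toPat (c := .name _) h₂.symm
        obtain rfl := Term.encode_injective h hM
        exact ⟨.of_eq (by simp [mul_comm]) (.comm M N Q P) (by simp [mul_comm]),
          Proc.encode_subst_inst [N] P, Proc.encode_subst_inst_shift [.name (τ .input)] Q⟩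
  obtain ⟨p, A, q, B, σ, ρ, hU', hT', hu, rfl⟩ := hr
  cases hT with
  | ok => cases hT'
  | inp M P =>
    cases hT'
    cases hU with
    | ok => cases hU'
    | inp M' Q =>
      cases hU'
      cases hu with
      | comp h₁ h₂ =>
        cases h₁ with
        | comp h₁ h₃ => exact (hb h₃).elim
    | out M' N Q =>
      cases hU'
      obtain ⟨hr, h₁, h₂⟩ := key (P := P) (Q := Q) hu
      exact ⟨_, hr, by rw [h₁, h₂]; rfl⟩
  | out M N P =>
    cases hT'
    cases hU with
    | ok => cases hU'
    | out M' N' Q =>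
      cases hU'
      cases hu with
      | comp h₁ h₂ => exact (hb h₂).elim
    | inp M' Q =>
      cases hU'
      obtain ⟨hr, h₁, h₂⟩ := key (P := Q) (Q := P) hu.symm
      exact ⟨_, .of_eq (by simp [mul_comm]) hr rfl, by rw [h₁, h₂]; simp [Proc.encode, mul_comm]⟩

theorem exists_red_of_interact_encode {g : Prop} (h : Admissible ι τ) {P Q : Proc} {R : CPC.Proc}
    (hi : CPC.Interact (P.encode ι τ) (Q.encode ι τ) R) :
    ∃ R', Red (.par P Q) R' ∧ CPC.cls g R = CPC.cls g (R'.encode ι τ) := by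
  obtain ⟨j, T, S, R₀, hT, hQ, h₁, hR⟩ := exists_of_expose_encode (CPC.natural_reactWith g) hi
  rw [Proc.encode_rename_add_lift] at h₁
  obtain ⟨i, U, S', R₁, hU, hP, h₂, hR'⟩ := exists_of_expose_encode (CPC.natural_react g) h₁
  rw [Proc.encode_rename_add_lift] at h₂
  obtain ⟨R₂, hr, hR₂⟩ := exists_red_of_react_encode (g := g) ((h.lift j).lift i)
    (hT.rename _) hU h₂
  refine ⟨Proc.res^[j] (.par (Proc.res^[i] (.par R₂ S')) S),
    .of_eq ?_ ((((hr.par S').iterate_res i).par S).iterate_res j) rfl, ?_⟩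
  · simp only [cls_par, cls_iterate_res]
    rw [mul_right_comm, iterate_res_mul, ← hP, hQ, mul_assoc, mul_comm (cls (P.rename _)),
      iterate_res_mul, mul_comm]
  · simp only [Proc.encode_iterate_res, CPC.cls_iterate_res, Proc.encode, CPC.cls_par, hR, hR',
      hR₂]

theorem exists_of_exposesOk_encode {P : Proc} {R : CPC.Proc}
    (h : CPC.ExposesOk (P.encode ι τ) R) : ∃ Q, Cong P (.par Q .ok) := by
  obtain ⟨j, T, S, R₀, hT, hP, h₁, -⟩ := exists_of_expose_encode (CPC.natural_showsOk False) h
  have hT' : T = .ok := by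
    cases hT with
    | ok => rfl
    | inp M P => cases h₁.2
    | out M N P => cases h₁.2
  subst hT'
  refine ⟨Proc.res^[j] S, cls_eq.1 ?_⟩
  rw [hP, cls_par, cls_iterate_res, mul_comm]
  exact iterate_res_mul j .ok _

/-! ### Unification with encoded terms -/

section Unify

variable {M N : Term} {σ ρ : List CPC.Comm}

theorem Term.eq_pair_of_unify (h : Admissible ι τ)
    (hu : CPC.Unify (.comp (.comp (.prot (τ .pair)) .bind) .bind) (M.encode ι τ).toPat σ ρ) :
    ∃ M₁ M₂, M = .pair M₁ M₂ ∧ σ = [M₁.encode ι τ, M₂.encode ι τ] ∧ ρ = [] := by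
  cases M with
  | name n => cases hu
  | zero => cases hu
  | suc M =>
    cases hu with
    | comp h₁ h₂ => cases h₁
  | pair M₁ M₂ =>
    cases hu with
    | comp h₁ h₂ =>
      cases h₁ with
      | comp h₁ h₃ =>
        cases h₁
        obtain ⟨rfl, rfl⟩ := h₂.bind_toPat
        obtain ⟨rfl, rfl⟩ := h₃.bind_toPat
        exact ⟨M₁, M₂, rfl, rfl, rfl⟩
  | encr M₁ M₂ =>
    cases hu with
    | comp h₁ h₂ =>
      cases h₁ with
      | comp h₁ h₃ =>
        cases h.tag_inj (CPC.Comm.name.inj (CPC.Unify.eq_of_prot_toPat (c := .name _) h₁).1)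

theorem Term.eq_encr_of_unify (h : Admissible ι τ)
    (hu : CPC.Unify (.comp (.comp (.prot (τ .encr)) .bind) (N.encode ι τ).toPat)
      (M.encode ι τ).toPat σ ρ) :
    ∃ M₁, M = .encr M₁ N ∧ σ = [M₁.encode ι τ] ∧ ρ = [] := by
  cases M with
  | name n => cases hu
  | zero => cases hu
  | suc M =>
    cases hu with
    | comp h₁ h₂ => cases h₁
  | encr M₁ M₂ =>
    cases hu with
    | comp h₁ h₂ =>
      cases h₁ with
      | comp h₁ h₃ =>
        cases h₁
        obtain ⟨hN, rfl, rfl⟩ := CPC.Unify.toPat_iff.1 h₂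
        obtain rfl := Term.encode_injective h hN
        obtain ⟨rfl, rfl⟩ := h₃.bind_toPat
        exact ⟨M₁, rfl, rfl, rfl⟩
  | pair M₁ M₂ =>
    cases hu with
    | comp h₁ h₂ =>
      cases h₁ with
      | comp h₁ h₃ =>
        cases h.tag_inj (CPC.Comm.name.inj (CPC.Unify.eq_of_prot_toPat (c := .name _) h₁).1)

theorem Term.eq_suc_of_unify 
    (hu : CPC.Unify (.comp (.prot (τ .suc)) .bind) (M.encode ι τ).toPat σ ρ) :
    ∃ M₁, M = .suc M₁ ∧ σ = [M₁.encode ι τ] ∧ ρ = [] := by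
  cases M with
  | name n => cases hu
  | zero => cases hu
  | suc M =>
    cases hu with
    | comp h₁ h₂ =>
      cases h₁
      obtain ⟨rfl, rfl⟩ := h₂.bind_toPat
      exact ⟨M, rfl, rfl, rfl⟩
  | pair M₁ M₂ =>
    cases hu with
    | comp h₁ h₂ => cases h₁
  | encr M₁ M₂ =>
    cases hu with
    | comp h₁ h₂ => cases h₁

theorem Term.eq_zero_of_unify (h : Admissible ι τ)
    (hu : CPC.Unify (.prot (τ .zero)) (M.encode ι τ).toPat σ ρ) :
    M = .zero ∧ σ = [] ∧ ρ = [] := by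
  obtain ⟨hM, rfl, rfl⟩ := hu.eq_of_prot_toPat
  exact ⟨Term.encode_injective h (hM.trans rfl), rfl, rfl⟩

end Unify

/-! ### Reductions of encodings -/

theorem Proc.encode_shift_res {g : Prop} (P : Proc) :
    (CPC.cls g (P.encode (ι · + 1) (τ · + 1))).res = CPC.cls g (P.encode ι τ) := by
  rw [← encode_rename_add, CPC.res_rename]

theorem exists_red_of_step_encode (h : Admissible ι τ) {P : Proc} {R : CPC.Proc}
    (hs : CPC.Step (P.encode ι τ) R) :
    ∃ P', Red P P' ∧ CPC.cls True R = CPC.cls True (P'.encode ι τ) := by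
  induction P generalizing ι τ R with
  | nil => cases hs
  | ok => cases hs
  | par P Q hP hQ =>
    cases hs with
    | interact hs => exact exists_red_of_interact_encode h hs
    | parL _ hs =>
      obtain ⟨P', hr, hR⟩ := hP h hs
      exact ⟨_, hr.par Q, by simp [Proc.encode, hR]⟩
    | parR _ hs =>
      obtain ⟨Q', hr, hR⟩ := hQ h hs
      exact ⟨.par P Q', .of_eq (by simp [mul_comm]) (hr.par P) (by simp [mul_comm]),
        by simp [Proc.encode, hR]⟩
  | repl P hP =>
    cases hs with
    | repl hs =>
      obtain ⟨P', hr, hR⟩ := hP h hs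
      exact ⟨.par P' (.repl P), .of_eq (repl_eq (cls P)) (hr.par (.repl P)) rfl,
        by simp [Proc.encode, hR]⟩
    | repl_interact hs =>
      obtain ⟨P', hr, hR⟩ := exists_red_of_interact_encode (g := True) h hs
      refine ⟨.par P' (.repl P), .of_eq ?_ (hr.par (.repl P)) rfl, by simp [Proc.encode, hR]⟩
      simp only [cls_par, cls_repl]
      rw [mul_assoc, ← repl_eq, ← repl_eq]
  | res P hP =>
    cases hs with
    | res hs =>
      obtain ⟨P', hr, hR⟩ := hP (h.lift 1) hs
      exact ⟨_, hr.res, by simp [Proc.encode, hR]⟩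
  | inp M P hP => cases hs
  | out M N P hP => cases hs
  | test M N P hP =>
    cases hs with
    | res hs =>
      cases hs with
      | parL _ hs => cases hs
      | parR _ hs => cases hs
      | interact hs =>
        obtain ⟨σ, ρ, hu, rfl⟩ := hs.of_case
        cases hu with
        | comp h₁ h₂ =>
          cases h₁
          obtain ⟨hM, rfl, rfl⟩ := CPC.Unify.toPat_iff.1 h₂
          obtain rfl := Term.encode_injective (h.shift 1) hM
          refine ⟨P, .test M P, ?_⟩
          simp [CPC.inst_nil, CPC.Proc.subst_name, CPC.Proc.subst, Proc.encode_shift_res]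
  | split M P hP =>
    cases hs with
    | res hs =>
      cases hs with
      | parL _ hs => cases hs
      | parR _ hs => cases hs
      | interact hs =>
        obtain ⟨σ, ρ, hu, rfl⟩ := hs.of_case
        cases hu with
        | comp h₁ h₂ =>
          cases h₁
          obtain ⟨M₁, M₂, rfl, rfl, rfl⟩ := Term.eq_pair_of_unify (h.shift 1) h₂
          refine ⟨_, .split M₁ M₂ P, ?_⟩
          have := Proc.encode_subst_inst (ι := (ι · + 1)) (τ := (τ · + 1)) [M₁, M₂] P
          simp only [List.map, List.length] at this
          simp [CPC.Proc.subst, this, Proc.encode_shift_res]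
  | decrypt M N P hP =>
    cases hs with
    | res hs =>
      cases hs with
      | parL _ hs => cases hs
      | parR _ hs => cases hs
      | interact hs =>
        obtain ⟨σ, ρ, hu, rfl⟩ := hs.of_case
        cases hu with
        | comp h₁ h₂ =>
          cases h₁
          obtain ⟨M₁, rfl, rfl, rfl⟩ := Term.eq_encr_of_unify (h.shift 1) h₂
          refine ⟨_, .decrypt M₁ N P, ?_⟩
          have := Proc.encode_subst_inst (ι := (ι · + 1)) (τ := (τ · + 1)) [M₁] P
          simp only [List.map, List.length] at this
          simp [CPC.Proc.subst, this, Proc.encode_shift_res]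
  | intCase M P Q hP hQ =>
    cases hs with
    | res hs =>
      cases hs with
      | parL _ hs => cases hs
      | interact hs =>
        cases hs with
        | parL _ hs =>
          obtain ⟨σ, ρ, hu, rfl⟩ := CPC.Interact.of_case hs
          cases hu with
          | comp h₁ h₂ => cases h₂
        | parR _ hs =>
          obtain ⟨σ, ρ, hu, rfl⟩ := CPC.Interact.of_case hs
          cases hu with
          | comp h₁ h₂ =>
            cases h₁
            obtain ⟨rfl, rfl, rfl⟩ := Term.eq_zero_of_unify (h.shift 1) h₂
            refine ⟨_, .intCase_zero P Q, ?_⟩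
            rw [CPC.cls_res, CPC.cls_par, ← Proc.encode_rename_add]
            simp [CPC.inst_nil, CPC.Proc.subst_name, CPC.Proc.subst, CPC.res_mul_rename,
              CPC.res_dead]
      | parR _ hs =>
        cases hs with
        | parL _ hs => cases hs
        | parR _ hs => cases hs
        | interact hs =>
          obtain ⟨σ, ρ, hu, rfl⟩ := hs.of_case
          cases hu with
          | comp h₁ h₂ =>
            cases h₁
            obtain ⟨N, rfl, rfl, rfl⟩ := Term.eq_suc_of_unify (ι := (ι · + 1)) (τ := (τ · + 1)) h₂
            refine ⟨_, .intCase_suc N P Q, ?_⟩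
            have := Proc.encode_subst_inst (ι := (ι · + 1)) (τ := (τ · + 1)) [N] Q
            simp only [List.map, List.length] at this
            rw [← Proc.encode_rename_add] at this
            simp [CPC.Proc.subst, this, CPC.res_mul_rename, CPC.res_dead]

theorem Red.exists_red_encode {P P' : Proc} (hr : Red P P') (ι : ℕ → ℕ) (τ : Tag → ℕ) :
    ∃ Q, CPC.Red (P.encode ι τ) Q ∧ CPC.cls True Q = CPC.cls True (P'.encode ι τ) := by
  have hc : ∀ c : CPC.Comm, CPC.Unify c.toPat c.toPat [] [] :=
    fun c => CPC.Unify.toPat_iff.2 ⟨rfl, rfl, rfl⟩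
  have hb : ∀ c : CPC.Comm, CPC.Unify .bind c.toPat [c] [] := fun c => .bind_left _ c rfl
  have h0 : CPC.Unify (.prot 0) (.prot 0) [] [] := .prot_prot 0
  induction hr generalizing ι τ with
  | comm M N P Q =>
    refine ⟨_, .unify _ _ (((hc _).comp (hb _).symm).comp (hb (.name _))), ?_⟩
    have h₁ := Proc.encode_subst_inst (ι := ι) (τ := τ) [N] Q
    have h₂ := Proc.encode_subst_inst_shift (ι := ι) (τ := τ) [.name (τ .input)] P
    simp only [List.map, List.length] at h₁ h₂
    simp [h₁, h₂, Proc.encode]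
  | test M P =>
    refine ⟨_, (CPC.Step.interact (.case (h0.comp (hc _)))).res.red, ?_⟩
    simp [CPC.inst_nil, CPC.Proc.subst_name, CPC.Proc.subst, Proc.encode_shift_res]
  | split M N P =>
    refine ⟨_, (CPC.Step.interact
      (.case (h0.comp (((CPC.Unify.prot_var _).comp (hb _)).comp (hb _))))).res.red, ?_⟩
    have := Proc.encode_subst_inst (ι := (ι · + 1)) (τ := (τ · + 1)) [M, N] P
    simp only [List.map, List.length] at this
    simp [CPC.Proc.subst, this, Proc.encode_shift_res]
  | decrypt M N P =>
    refine ⟨_, (CPC.Step.interact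
      (.case (h0.comp (((CPC.Unify.prot_var _).comp (hb _)).comp (hc _))))).res.red, ?_⟩
    have := Proc.encode_subst_inst (ι := (ι · + 1)) (τ := (τ · + 1)) [M] P
    simp only [List.map, List.length] at this
    simp [CPC.Proc.subst, this, Proc.encode_shift_res]
  | intCase_zero P Q =>
    refine ⟨_, (CPC.Step.interact (CPC.Expose.parR _
      (CPC.Interact.case (h0.comp (CPC.Unify.prot_var _))))).res.red, ?_⟩
    rw [CPC.cls_res, CPC.cls_par, ← Proc.encode_rename_add]
    simp [CPC.inst_nil, CPC.Proc.subst_name, CPC.Proc.subst, CPC.res_mul_rename, CPC.res_dead]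
  | intCase_suc N P Q =>
    refine ⟨_, (CPC.Step.parR _ (CPC.Step.interact (CPC.Interact.case
      (h0.comp ((CPC.Unify.prot_var _).comp (hb _)))))).res.red, ?_⟩
    have := Proc.encode_subst_inst (ι := (ι · + 1)) (τ := (τ · + 1)) [N] Q
    simp only [List.map, List.length] at this
    rw [← Proc.encode_rename_add] at this
    simp [CPC.Proc.subst, this, CPC.res_mul_rename, CPC.res_dead]
  | par Q _ ih =>
    obtain ⟨R, h, hR⟩ := ih ι τ
    exact ⟨_, h.par _, by simp [hR, Proc.encode]⟩
  | res _ ih =>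
    obtain ⟨R, h, hR⟩ := ih (liftRenaming 1 ι) (τ · + 1)
    exact ⟨_, h.res, by simp [hR, Proc.encode]⟩
  | struct h₁ _ h₂ ih =>
    obtain ⟨R, h, hR⟩ := ih ι τ
    exact ⟨R, .struct (h₁.encode ι τ) h (.refl _), hR.trans ((h₂.encode ι τ).gcong True).eq⟩

theorem exists_red_of_red_encode (h : Admissible ι τ) {P : Proc} {Q : CPC.Proc}
    (hr : CPC.Red (P.encode ι τ) Q) :
    ∃ P', Red P P' ∧ CPC.GCong True Q (P'.encode ι τ) := by
  obtain ⟨Q', hs, hQ⟩ := hr.step True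
  obtain ⟨P', hr, hP⟩ := exists_red_of_step_encode h hs
  exact ⟨P', hr, CPC.cls_eq.1 (hQ.trans hP)⟩

theorem exists_reds_encode {P P' : Proc} (hr : Relation.ReflTransGen Red P P') (ι : ℕ → ℕ)
    (τ : Tag → ℕ) : ∃ Q, Relation.ReflTransGen CPC.Red (P.encode ι τ) Q ∧
      CPC.GCong True Q (P'.encode ι τ) := by
  induction hr with
  | refl => exact ⟨_, .refl, .refl _⟩
  | tail _ hr ih =>
    obtain ⟨Q, h₁, h₂⟩ := ih
    obtain ⟨R, h₃, h₄⟩ := hr.exists_red_encode ι τ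
    obtain ⟨R', h₅, h₆⟩ := h₂.symm.red h₃
    exact ⟨R', h₁.tail h₅, h₆.symm.trans (CPC.cls_eq.1 h₄)⟩

theorem exists_reds_of_reds_encode (h : Admissible ι τ) {P : Proc} {Q : CPC.Proc}
    (hr : Relation.ReflTransGen CPC.Red (P.encode ι τ) Q) :
    ∃ P', Relation.ReflTransGen Red P P' ∧ CPC.GCong True Q (P'.encode ι τ) := by
  induction hr with
  | refl => exact ⟨P, .refl, .refl _⟩
  | tail _ hr ih =>
    obtain ⟨P₁, h₁, h₂⟩ := ih
    obtain ⟨R, h₃, h₄⟩ := h₂.red hr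
    obtain ⟨P₂, h₅, h₆⟩ := exists_red_of_red_encode h h₃
    exact ⟨P₂, h₁.tail h₅, h₄.trans h₆⟩

theorem diverges_of_diverges_encode (h : Admissible ι τ) {P : Proc}
    (hd : CPC.Diverges (P.encode ι τ)) : Diverges P := by
  obtain ⟨F, h0, hF⟩ := hd
  have next : ∀ i (S : {S : Proc // CPC.GCong True (F i) (S.encode ι τ)}),
      ∃ S' : {S : Proc // CPC.GCong True (F (i + 1)) (S.encode ι τ)}, Red S.1 S'.1 := by
    rintro i ⟨S, hS⟩
    obtain ⟨R, h₁, h₂⟩ := hS.red (hF i)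
    obtain ⟨S', h₃, h₄⟩ := exists_red_of_red_encode h h₁
    exact ⟨⟨S', h₂.trans h₄⟩, h₃⟩
  choose G hG using next
  let S : ∀ i, {S : Proc // CPC.GCong True (F i) (S.encode ι τ)} :=
    fun i => Nat.rec ⟨P, h0 ▸ .refl _⟩ (fun i S => G i S) i
  exact ⟨fun i => (S i).1, rfl, fun i => hG i (S i)⟩

theorem succeeds_iff_succeeds_encode (h : Admissible ι τ) {P : Proc} :
    Succeeds P ↔ CPC.Succeeds (P.encode ι τ) := by
  constructor
  · rintro ⟨P', P'', hr, hc⟩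
    obtain ⟨Q, h₁, h₂⟩ := exists_reds_encode hr ι τ
    obtain ⟨Q', hQ⟩ := h₂.symm.exists_cong_par_ok ⟨_, hc.encode ι τ⟩
    exact ⟨Q, Q', h₁, hQ⟩
  · rintro ⟨Q, Q', hr, hc⟩
    obtain ⟨P', h₁, h₂⟩ := exists_reds_of_reds_encode h hr
    obtain ⟨R, hR⟩ := CPC.cong_par_ok_iff.1 (h₂.exists_cong_par_ok ⟨_, hc⟩)
    obtain ⟨P'', h₃⟩ := exists_of_exposesOk_encode hR
    exact ⟨P', P'', h₁, h₃⟩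

/-! ### Name invariance and compositionality -/

theorem encode_name_invariance (h : Admissible ι τ) (σ : ℕ → ℕ) : ∃ σ' : ℕ → ℕ,
    (∀ a, ι (σ a) = σ' (ι a)) ∧ (∀ c, (∀ a, ι a ≠ c) → σ' c = c) ∧
    ∀ P : Proc, (P.rename σ).encode ι τ = (P.encode ι τ).rename σ' := by
  have h₁ : ∀ a, ι (σ a) = Function.extend ι (ι ∘ σ) id (ι a) := fun a =>
    (h.inj.extend_apply (ι ∘ σ) id a).symm
  have h₂ : ∀ c, (∀ a, ι a ≠ c) → Function.extend ι (ι ∘ σ) id c = c := fun c hc =>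
    Function.extend_apply' _ _ c (fun ⟨a, ha⟩ => hc a ha)
  exact ⟨_, h₁, h₂, fun P => (Proc.encode_rename P (fun a _ => (h₁ a).symm)
    fun t => h₂ _ fun a => h.ne a t).symm⟩

theorem closeNames_of_notMem {xs : List ℕ} {n : ℕ} (h : n ∉ xs) :
    closeNames xs n = n + xs.length := if_neg h

theorem closeNames_map (h : Function.Injective ι) (xs : List ℕ) (a : ℕ) :
    closeNames (xs.map ι) (ι a) = liftRenaming xs.length ι (closeNames xs a) := by
  by_cases ha : a ∈ xs
  · have hi : (xs.map ι).idxOf (ι a) = xs.idxOf a := by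
      induction xs with
      | nil => rfl
      | cons x xs ih =>
        by_cases hx : x = a
        · simp [hx]
        · have := ih (by simpa [Ne.symm hx] using ha)
          rw [List.map_cons, List.idxOf_cons_ne _ (h.ne hx), List.idxOf_cons_ne _ hx, this]
    rw [closeNames, if_pos (List.mem_map_of_mem ha), closeNames, if_pos ha, hi,
      liftRenaming_lt _ (List.idxOf_lt_length_of_mem ha)]
  · rw [closeNames_of_notMem ha, closeNames_of_notMem (by simpa [h.eq_iff] using ha)]
    simp

theorem Proc.encode_rename_closeNames (h : Admissible ι τ) (xs : List ℕ) (P : Proc) :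
    (P.encode ι τ).rename (closeNames (xs.map ι)) =
      (P.rename (closeNames xs)).encode (liftRenaming xs.length ι) (τ · + xs.length) :=
  encode_rename P (fun a _ => closeNames_map h.inj xs a) fun t => by
    rw [closeNames_of_notMem, List.length_map]
    simpa using fun a _ => h.ne a t

/-- The name `n` does not occur in encodings of processes with free names in `N`. -/
structure Fresh (ι : ℕ → ℕ) (τ : Tag → ℕ) (N : Set ℕ) (n : ℕ) : Prop where
  name : ∀ a ∈ N, ι a ≠ n
  tag : ∀ t, τ t ≠ n

theorem Proc.encode_rename_closeNames_fresh {n : ℕ} {P : Proc} (h : Fresh ι τ P.fn n) :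
    (P.encode ι τ).rename (closeNames [n]) = P.encode (ι · + 1) (τ · + 1) := by
  rw [encode_rename (k := id) (ι' := (ι · + 1)) (τ' := (τ · + 1)) P, rename_id]
  · exact fun a ha => closeNames_of_notMem (by simpa using h.name a ha)
  · exact fun t => closeNames_of_notMem (by simpa using h.tag t)

theorem Term.finite_fn (M : Term) : M.fn.Finite := by
  induction M with
  | name n => exact Set.finite_singleton n
  | zero => exact Set.finite_empty
  | suc M hM => exact hM
  | pair M N hM hN => exact hM.union hN
  | encr M N hM hN => exact hM.union hN

theorem finite_setOf_add_mem {s : Set ℕ} (h : s.Finite) (k : ℕ) : {n | n + k ∈ s}.Finite :=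
  h.preimage ((add_left_injective k).injOn)

theorem Proc.finite_fn (P : Proc) : P.fn.Finite := by
  induction P with
  | nil => exact Set.finite_empty
  | ok => exact Set.finite_empty
  | par P Q hP hQ => exact hP.union hQ
  | repl P hP => exact hP
  | res P hP => exact finite_setOf_add_mem hP 1
  | inp M P hP => exact M.finite_fn.union (finite_setOf_add_mem hP 1)
  | out M N P hP => exact (M.finite_fn.union N.finite_fn).union hP
  | test M N P hP => exact (M.finite_fn.union N.finite_fn).union hP
  | split M P hP => exact M.finite_fn.union (finite_setOf_add_mem hP 2)
  | decrypt M N P hP => exact (M.finite_fn.union N.finite_fn).union (finite_setOf_add_mem hP 1)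
  | intCase M P Q hP hQ => exact (M.finite_fn.union hP).union (finite_setOf_add_mem hQ 1)

theorem Fresh.mono {s t : Set ℕ} {n : ℕ} (h : Fresh ι τ t n) (hs : s ⊆ t) : Fresh ι τ s n :=
  ⟨fun a ha => h.name a (hs ha), h.tag⟩

theorem exists_fresh (ι : ℕ → ℕ) (τ : Tag → ℕ) {N : Set ℕ} (hN : N.Finite) :
    ∃ n, Fresh ι τ N n := by
  have ht : (Set.range τ).Finite := by
    refine (Set.toFinite {τ .pair, τ .encr, τ .zero, τ .suc, τ .input}).subset ?_
    rintro _ ⟨t, rfl⟩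
    cases t <;> simp
  obtain ⟨n, hn⟩ := ((hN.image ι).union ht).exists_notMem
  exact ⟨n, fun a ha e => hn (.inl ⟨a, ha, e⟩), fun t e => hn (.inr ⟨t, e⟩)⟩

theorem Term.encode_toPat_rename_closeNames {n : ℕ} {M : Term} (h : Fresh ι τ M.fn n) :
    (M.encode ι τ).toPat.rename (closeNames [n]) = (M.encode (ι · + 1) (τ · + 1)).toPat := by
  rw [CPC.Pat.rename, encode_toPat_subst (f := .name) (ι' := (ι · + 1)) (τ' := (τ · + 1)),
    subst_name]
  exact ⟨fun a ha => congrArg _ (closeNames_of_notMem (by simpa using h.name a ha)),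
    fun t => congrArg _ (closeNames_of_notMem (by simpa using h.tag t))⟩

theorem Proc.encode_rename_closeNames_lift (h : Admissible ι τ) {n : ℕ} {P : Proc}
    (hn : Fresh ι τ P.fn n) (xs : List ℕ) :
    ((P.encode ι τ).rename (closeNames (xs.map ι))).rename
      (liftRenaming xs.length (closeNames [n])) =
      (P.rename (closeNames xs)).encode (liftRenaming xs.length (ι · + 1))
        (τ · + 1 + xs.length) := by
  rw [CPC.Proc.rename_rename]
  refine encode_rename P (fun a ha => ?_) fun t => ?_
  · rw [Function.comp_apply, closeNames_map h.inj]
    by_cases hx : a ∈ xs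
    · have : closeNames xs a < xs.length := by
        rw [closeNames, if_pos hx]; exact List.idxOf_lt_length_of_mem hx
      simp only [liftRenaming_lt _ this]
    · rw [closeNames_of_notMem hx, liftRenaming_add, liftRenaming_add, liftRenaming_add,
        closeNames_of_notMem (by simpa using hn.name a ha)]
      rfl
  · rw [Function.comp_apply, closeNames_of_notMem (by simpa using fun a _ => h.ne a t),
      List.length_map, liftRenaming_add, closeNames_of_notMem (by simpa using hn.tag t)]
    rfl

theorem closeNames_nil : closeNames [] = id := rfl

/-- The names in the terms of an operator. -/
def Op.termNames : Op → Set ℕ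
  | inp M _ => M.fn
  | out M N => M.fn ∪ N.fn
  | test M N => M.fn ∪ N.fn
  | split _ _ _ M => M.fn
  | decrypt M _ N => M.fn ∪ N.fn
  | intCase M _ => M.fn
  | _ => ∅

theorem Op.finite_termNames (op : Op) : op.termNames.Finite := by
  cases op <;> simp [termNames, Term.finite_fn]

/-- The context that encodes an operator; `n` is used where a fresh name is needed. -/
def Op.context (ι : ℕ ↪ ℕ) (τ : Tag → ℕ) (n : ℕ) : Op → CPC.Ctx
  | nil => .nil
  | ok => .ok
  | par => .par (.hole 0) (.hole 1)
  | repl => .repl (.hole 0)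
  | res m => .res (ι m) (.hole 0)
  | inp M x =>
      .case (.comp (.comp (M.encode ι τ).toPat .bind) (.var (τ .input))) [ι x]
        (by simp [CPC.Pat.binders]) (.hole 0)
  | out M N =>
      .case (.comp (.comp (M.encode ι τ).toPat (N.encode ι τ).toPat) .bind) [n]
        (by simp [CPC.Pat.binders]) (.hole 0)
  | test M N =>
      .res n (.par
        (.case (.comp (.prot n) (M.encode ι τ).toPat) [] (by simp [CPC.Pat.binders]) (.hole 0))
        (.case (.comp (.prot n) (N.encode ι τ).toPat) [] (by simp [CPC.Pat.binders]) .nil))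
  | split x y h M =>
      .res n (.par
        (.case (.comp (.prot n) (.comp (.comp (.prot (τ .pair)) .bind) .bind)) [ι x, ι y]
          (by simp [CPC.Pat.binders, h]) (.hole 0))
        (.case (.comp (.prot n) (M.encode ι τ).toPat) [] (by simp [CPC.Pat.binders]) .nil))
  | decrypt M x N =>
      .res n (.par
        (.case (.comp (.prot n) (.comp (.comp (.prot (τ .encr)) .bind) (N.encode ι τ).toPat)) [ι x]
          (by simp [CPC.Pat.binders]) (.hole 0))
        (.case (.comp (.prot n) (M.encode ι τ).toPat) [] (by simp [CPC.Pat.binders]) .nil))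
  | intCase M x =>
      .res n (.par
        (.case (.comp (.prot n) (.prot (τ .zero))) [] (by simp [CPC.Pat.binders]) (.hole 0))
        (.par
          (.case (.comp (.prot n) (.comp (.prot (τ .suc)) .bind)) [ι x]
            (by simp [CPC.Pat.binders]) (.hole 1))
          (.case (.comp (.prot n) (M.encode ι τ).toPat) [] (by simp [CPC.Pat.binders]) .nil)))

theorem Op.isContext_context (ι : ℕ ↪ ℕ) (τ : Tag → ℕ) (n : ℕ) (op : Op) :
    (op.context ι τ n).IsContext op.arity := by
  cases op <;> rfl

theorem Op.plug_context {ι : ℕ ↪ ℕ} (h : Admissible ι τ) {n : ℕ} (op : Op) (S : ℕ → Proc)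
    (hn : Fresh ι τ op.termNames n) (hS : ∀ i < op.arity, Fresh ι τ (S i).fn n) :
    (op.apply S).encode ι τ = (op.context ι τ n).plug fun i => (S i).encode ι τ := by
  have hc : closeNames [n] n = 0 := by simp [closeNames]
  have ht : ∀ t, closeNames [n] (τ t) = τ t + 1 := fun t =>
    closeNames_of_notMem (by simpa using hn.tag t)
  have hx : ∀ (P : Proc) (x : ℕ), (P.encode ι τ).rename (closeNames [ι x]) =
    (P.rename (closeNames [x])).encode (liftRenaming 1 ι) (τ · + 1) := fun P x =>
      Proc.encode_rename_closeNames h [x] P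
  have h₀ : ∀ {P : Proc}, Fresh ι τ P.fn n →
      ((P.encode ι τ).rename (closeNames [])).rename (liftRenaming 0 (closeNames [n])) =
        P.encode (ι · + 1) (τ · + 1) := fun hP => by
    rw [liftRenaming_zero, closeNames_nil, CPC.Proc.rename_id,
      Proc.encode_rename_closeNames_fresh hP]
  have h₁ : ∀ {P : Proc}, Fresh ι τ P.fn n → ∀ x,
      ((P.encode ι τ).rename (closeNames [ι x])).rename (liftRenaming 1 (closeNames [n])) =
        (P.rename (closeNames [x])).encode (liftRenaming 1 (ι · + 1)) (τ · + 1 + 1) :=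
    fun hP x => Proc.encode_rename_closeNames_lift h hP [x]
  cases op with
  | nil => rfl
  | ok => rfl
  | par => rfl
  | repl => rfl
  | res m => simp only [apply, context, Proc.encode, CPC.Ctx.plug, hx]
  | inp M x => simp only [apply, context, Proc.encode, CPC.Ctx.plug, hx]
  | out M N =>
    simp only [apply, context, Proc.encode, CPC.Ctx.plug]
    rw [Proc.encode_rename_closeNames_fresh (hS 0 one_pos)]
  | test M N =>
    have hM := Term.encode_toPat_rename_closeNames (M := M) (hn.mono Set.subset_union_left)
    have hN := Term.encode_toPat_rename_closeNames (M := N) (hn.mono Set.subset_union_right)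
    simp only [CPC.Pat.rename] at hM hN
    simp [apply, context, Proc.encode, CPC.Ctx.plug, CPC.Pat.subst, CPC.Pat.binders, hc,
      CPC.Comm.protect, hM, hN, h₀ (hS 0 one_pos)]
  | split x y hxy M =>
    have hM := Term.encode_toPat_rename_closeNames (hn : Fresh ι τ M.fn n)
    have h₂ := Proc.encode_rename_closeNames_lift h (hS 0 one_pos) [x, y]
    simp only [CPC.Pat.rename, List.map, List.length] at hM h₂
    simp [apply, context, Proc.encode, CPC.Ctx.plug, CPC.Pat.subst, CPC.Pat.binders, hc,
      CPC.Comm.protect, hM, ht, h₂]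
  | decrypt M x N =>
    have hM := Term.encode_toPat_rename_closeNames (M := M) (hn.mono Set.subset_union_left)
    have hN := Term.encode_toPat_rename_closeNames (M := N) (hn.mono Set.subset_union_right)
    simp only [CPC.Pat.rename] at hM hN
    simp [apply, context, Proc.encode, CPC.Ctx.plug, CPC.Pat.subst, CPC.Pat.binders, hc,
      CPC.Comm.protect, hM, hN, ht, h₁ (hS 0 one_pos)]
  | intCase M x =>
    have hM := Term.encode_toPat_rename_closeNames (hn : Fresh ι τ M.fn n)
    simp only [CPC.Pat.rename] at hM
    simp [apply, context, Proc.encode, CPC.Ctx.plug, CPC.Pat.subst, CPC.Pat.binders, hc,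
      CPC.Comm.protect, hM, ht, h₀ (hS 0 two_pos), h₁ (hS 1 one_lt_two)]

theorem encode_compositional {ι : ℕ ↪ ℕ} (h : Admissible ι τ) (op : Op) (N : Set ℕ) :
    ∃ C : CPC.Ctx, C.IsContext op.arity ∧
      ∀ S : ℕ → Proc, (⋃ i < op.arity, (S i).fn) = N →
        (op.apply S).encode ι τ = C.plug fun i => (S i).encode ι τ := by
  by_cases hN : N.Finite
  · obtain ⟨n, hn⟩ := exists_fresh ι τ (hN.union op.finite_termNames)
    refine ⟨op.context ι τ n, op.isContext_context ι τ n, fun S hS => ?_⟩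
    refine op.plug_context h S (hn.mono Set.subset_union_right) fun i hi => ?_
    refine hn.mono (Set.Subset.trans ?_ Set.subset_union_left)
    rw [← hS]
    exact Set.subset_biUnion_of_mem (u := fun i => (S i).fn) (s := {i | i < op.arity}) hi
  · refine ⟨op.context ι τ 0, op.isContext_context ι τ 0, fun S hS => (hN ?_).elim⟩
    rw [← hS]
    exact (Set.finite_lt_nat op.arity).biUnion fun i _ => (S i).finite_fn

end Spi

/-- For every choice `ι` of CPC names for the Spi names and every choice `τ` of reserved names. -/
theorem mainTheorem6 (ι : ℕ ↪ ℕ) (τ : Tag ↪ ℕ) (h : ∀ a t, ι a ≠ τ t) :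
    IsValidEncoding (Spi.Proc.encode ι τ) (fun a (_ : Fin 1) => ι a) ∧
    (∀ P P' : Spi.Proc, Spi.Red P P' →
      ∃ Q : CPC.Proc, CPC.Red (P.encode ι τ) Q ∧ CPC.BarbedCong Q (P'.encode ι τ)) ∧
    (∀ (P : Spi.Proc) (Q : CPC.Proc), CPC.Red (P.encode ι τ) Q →
      ∃ P' : Spi.Proc, Spi.Red P P' ∧ CPC.BarbedCong Q (P'.encode ι τ)) := by
  have ha : Spi.Admissible ι τ := ⟨ι.injective, τ.injective, h⟩
  refine ⟨⟨one_pos, Spi.encode_compositional ha, fun σ => ?_, fun S S' hr => ?_,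
    fun S T hr => ?_, fun S => Spi.diverges_of_diverges_encode ha,
    fun S => Spi.succeeds_iff_succeeds_encode ha⟩, fun P P' hr => ?_, fun P Q hr => ?_⟩
  · obtain ⟨σ', h₁, h₂, h₃⟩ := Spi.encode_name_invariance ha σ
    refine ⟨σ', fun a _ => h₁ a, fun c hc => h₂ c fun a => hc a 0, fun S => ⟨fun _ => h₃ S,
      fun _ => ?_⟩⟩
    rw [h₃ S]
    exact (CPC.GCong.refl (g := True) _).barbedCong
  · obtain ⟨Q, h₁, h₂⟩ := Spi.exists_reds_encode hr ι τ
    exact ⟨Q, h₁, h₂.barbedCong⟩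
  · obtain ⟨S', h₁, h₂⟩ := Spi.exists_reds_of_reds_encode ha hr
    exact ⟨S', T, h₁, .refl, h₂.barbedCong⟩
  · obtain ⟨Q, h₁, h₂⟩ := hr.exists_red_encode ι τ
    exact ⟨Q, h₁, (CPC.cls_eq.1 h₂).barbedCong⟩
  · obtain ⟨P', h₁, h₂⟩ := Spi.exists_red_of_red_encode ha hr
    exact ⟨P', h₁, h₂.barbedCong⟩
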